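/- **Setting.** Consider $N$ fermionic modes with annihilation operators $f_1,\dots,f_N$ acting on the $2^N$-dimensional Fock space $\mathcal H$, parity operator $(-1)^F=(-1)^{\sum_j f_j^\dagger f_j}$, and Majorana operators $c_{2j-1}=f_j^\dagger+f_j$, $c_{2j}=-i(f_j^\dagger-f_j)$. An operator is *physical* if it commutes with $(-1)^F$; a *state* is a physical positive semidefinite operator of trace $1$. The modes are divided into a set $A$ and its complement $B$; a *local physical operator* on a set of modes is a physical operator in the algebra generated by the Majorana operators of these modes. For a physical operator $X=\sum_S X_S c_S$, where $S=\{p_1<\dots<p_k\}\subseteq\{1,\dots,2N\}$ and $c_S=c_{p_1}\cdots c_{p_k}$, the fermionic partial transpose is $$X^{\mathsf T_A}=\sum_S X_S\, i^{k_A(S)}\,c_S,$$ where $k_A(S)$ is the number of Majorana operators in $c_S$ that belong to modes of $A$. With $\|X\|=\operatorname{Tr}\sqrt{XX^\dagger}$, the fermionic negativity and logarithmic negativity are $$\mathcal N(\rho)=\tfrac12\bigl(\|\rho^{\mathsf T_A}\|-1\bigr),\qquad \mathcal E(\rho)=\log\|\rho^{\mathsf T_A}\| .$$ An *ancilla* $R$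 is a further system of $M$ fermionic modes; whenever it is present, it is joined to $A$, that is, the partial transpose of operators on the combined system is taken with respect to $\tilde A=AR$. **Theorem.** Let $\rho$ be a state on $AB$. 1. *(Appending an ancilla.)* For every state $\rho_R$ of an ancilla $R$, $$\mathcal N(\rho\otimes\rho_R)=\mathcal N(\rho),\qquad \mathcal E(\rho\otimes\rho_R)=\mathcal E(\rho).$$ 2. *(Local projective measurements.)* Let $(P_A^\mu)_\mu$ and $(P_B^\mu)_\mu$ be finite families of local physical orthogonal projections ($P^2=P=P^\dagger$) on $A$ and on $B$, such that the products $P^\mu=P_A^\mu P_B^\mu$ are mutually orthogonal: $P^\mu P^\nu=0$ for $\mu\ne\nu$. Put $r_\mu=\operatorname{Tr}(P^\mu\rho P^\mu)$ and $\rho(\mu)=r_\mu^{-1}P^\mu\rho P^\mu$ (terms with $r_\mu=0$ are read as $0$ below). Then $r_\mu\ge0$, $\sum_\mu r_\mu=1$ if $\sum_\mu P^\mu=\mathbb I$, and $$\mathcal N(\rho)\ge\sum_\mu r_\mu\,\mathcal N(\rho(\mu)),\qquad \mathcal E(\rho)\ge\sum_\mu r_\mu\,\mathcal E(\rho(\mu)).$$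 3. *(Entangling with an ancilla, then measuring it or tracing it out.)* Let $\rho_R$ be a state of an ancilla $R$, let $U$ be a unitary local physical operator on $AR$, and put $\rho'=U(\rho\otimes\rho_R)U^\dagger$. Let $\{|\mu\rangle\}$ be an orthonormal basis of the Fock space of $R$ consisting of vectors of definite fermion parity, and put $r_\mu=\operatorname{Tr}\bigl({}_R\langle\mu|\rho'|\mu\rangle_R\bigr)$ and $\rho(\mu)=r_\mu^{-1}\,{}_R\langle\mu|\rho'|\mu\rangle_R$ (terms with $r_\mu=0$ are read as $0$). Then $r_\mu\ge0$, $\sum_\mu r_\mu=1$, $\operatorname{Tr}_R\rho'=\sum_\mu r_\mu\,\rho(\mu)$, and $$\mathcal N(\rho)\ge\sum_\mu r_\mu\,\mathcal N(\rho(\mu)),\qquad \mathcal N(\rho)\ge\mathcal N\Bigl(\sum_\mu r_\mu\,\rho(\mu)\Bigr),\qquad \mathcal E(\rho)\ge\sum_\mu r_\mu\,\mathcal E(\rho(\mu)).$$ -/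

import Mathlib

open scoped Matrix ComplexOrder MatrixOrder

noncomputable section

namespace Fermion

/-- Occupation numbers `(n_1, …, n_N)`, `n_j ∈ {0, 1}`, of `N` fermionic modes: the labels of the
standard orthonormal basis of the Fock space. -/
abbrev Occ (N : ℕ) : Type := Fin N → Fin 2

/-- The Fock space of `N` local fermionic modes, of dimension `2 ^ N`. -/
abbrev Fock (N : ℕ) : Type := EuclideanSpace ℂ (Occ N)

/-- Linear operators on the Fock space, as matrices in the occupation number basis. -/
abbrev Op (N : ℕ) : Type := Matrix (Occ N) (Occ N) ℂ

/-- The annihilation operator `f_j`: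
`f_j |n⟩ = (-1) ^ (∑_{i < j} n_i) |n with n_j set to 0⟩` if `n_j = 1`, and `0` if `n_j = 0`. -/
def annihilation {N : ℕ} (j : Fin N) : Op N :=
  Matrix.of fun n' n =>
    if n j = 1 ∧ n' = Function.update n j 0 then
      (-1 : ℂ) ^ (∑ i ∈ Finset.univ.filter (fun i => i < j), (n i : ℕ))
    else 0

/-- The creation operator `f_j†`. -/
def creation {N : ℕ} (j : Fin N) : Op N := (annihilation j)ᴴ

/-- The `2N` Majorana operators, numbered from `0`: the mode `j` carries `f_j† + f_j` (number `2j`)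
and `-i (f_j† - f_j)` (number `2j + 1`). Thus `k.divNat` is the mode of the operator `k`. -/
def majorana {N : ℕ} (k : Fin (N * 2)) : Op N :=
  if k.modNat = 0 then creation k.divNat + annihilation k.divNat
  else (-Complex.I) • (creation k.divNat - annihilation k.divNat)

/-- The Majorana monomial `c_{p_1} ⋯ c_{p_k}` for `S = {p_1 < ⋯ < p_k}`. -/
def monomial {N : ℕ} (S : Finset (Fin (N * 2))) : Op N :=
  ((S.sort (· ≤ ·)).map majorana).prod

/-- The coefficient `X_S = 2^{-N} Tr (c_S† X)` in the expansion `X = ∑_S X_S c_S`. -/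
def coeff {N : ℕ} (X : Op N) (S : Finset (Fin (N * 2))) : ℂ :=
  ((monomial S)ᴴ * X).trace / 2 ^ N

/-- The fermion-number parity operator `(-1)^F`. -/
def parity (N : ℕ) : Op N := Matrix.diagonal fun n => (-1 : ℂ) ^ (∑ j, (n j : ℕ))

/-- Physical operators, i.e. those that preserve the fermion-number parity. -/
def IsPhysical {N : ℕ} (X : Op N) : Prop := parity N * X * parity N = X

/-- State vectors of definite fermion-number parity. -/
def HasDefiniteParity {N : ℕ} (v : Fock N) : Prop :=
  parity N *ᵥ v.ofLp = v.ofLp ∨ parity N *ᵥ v.ofLp = -v.ofLp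

/-- Density matrices of a fermionic system. -/
structure IsDensity {N : ℕ} (ρ : Op N) : Prop where
  posSemidef : ρ.PosSemidef
  trace_eq_one : ρ.trace = 1
  physical : IsPhysical ρ

/-- The algebra of the operators that are local to the set `A` of modes: it is generated by the
Majorana operators of these modes. -/
def localAlgebra {N : ℕ} (A : Finset (Fin N)) : Subalgebra ℂ (Op N) :=
  Algebra.adjoin ℂ {X | ∃ k : Fin (N * 2), k.divNat ∈ A ∧ X = majorana k}

/-- Local physical operators on the set `A` of modes. -/
def IsLocalPhysical {N : ℕ} (A : Finset (Fin N)) (X : Op N) : Prop :=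
  X ∈ localAlgebra A ∧ IsPhysical X

/-- The fermionic partial transpose with respect to the set `A` of modes: a Majorana monomial that
contains `k₁` Majorana operators of `A` is multiplied by `i ^ k₁`. (Reordering the operators in a
monomial changes it by a sign only, so no operators of `A` have to be moved to the left.) -/
def partialTranspose {N : ℕ} (A : Finset (Fin N)) (X : Op N) : Op N :=
  ∑ S : Finset (Fin (N * 2)),
    (coeff X S * Complex.I ^ (S.filter fun k => k.divNat ∈ A).card) • monomial S

/-- The trace norm `Tr √(X X†)`. -/
def traceNorm {N : ℕ} (X : Op N) : ℝ := (CFC.sqrt (X * Xᴴ)).trace.re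

/-- The fermionic negativity for the bipartition of the modes into `A` and its complement. -/
def negativity {N : ℕ} (A : Finset (Fin N)) (ρ : Op N) : ℝ :=
  (traceNorm (partialTranspose A ρ) - 1) / 2

/-- The fermionic logarithmic negativity. -/
def logNegativity {N : ℕ} (A : Finset (Fin N)) (ρ : Op N) : ℝ :=
  Real.log (traceNorm (partialTranspose A ρ))

/-! ### Projective measurements: outcome `P`, on the state `ρ` -/

/-- The probability `Tr (P ρ P)`. -/
def outcomeProb {N : ℕ} (P ρ : Op N) : ℝ := (P * ρ * P).trace.re

/-- The state `P ρ P / Tr (P ρ P)` after the measurement. -/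
def outcomeState {N : ℕ} (P ρ : Op N) : Op N := ((outcomeProb P ρ : ℂ)⁻¹) • (P * ρ * P)

/-! ### Ancillas

The `M` modes of the ancilla `R` are numbered before the `N` modes of the system `AB`, so that the
Fock space is `H^R ⊗ H^{AB}` and `|s⟩ ⊗ |n⟩` is the occupation number state `Fin.append s n`. -/

/-- The modes of the ancilla together with the modes in `A`. -/
def withAncilla (M : ℕ) {N : ℕ} (A : Finset (Fin N)) : Finset (Fin (M + N)) :=
  Finset.univ.image (Fin.castAdd N) ∪ A.image (Fin.natAdd M)

/-- The tensor product of an operator on the ancilla and an operator on the system. (For physical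
operators, which commute with each other, it is also their graded tensor product.) -/
def tensor {M N : ℕ} (Y : Op M) (X : Op N) : Op (M + N) :=
  Matrix.of fun n n' =>
    Y (fun i => n (Fin.castAdd N i)) (fun i => n' (Fin.castAdd N i)) *
      X (fun j => n (Fin.natAdd M j)) (fun j => n' (Fin.natAdd M j))

/-- The operator `⟨v|_R X |v⟩_R` on the system, for a state vector `v` of the ancilla. -/
def ancillaSandwich {M N : ℕ} (v : Fock M) (X : Op (M + N)) : Op N :=
  Matrix.of fun n n' =>
    ∑ s : Occ M, ∑ s' : Occ M, star (v s) * X (Fin.append s n) (Fin.append s' n') * v s'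

/-- The partial trace `Tr_R X` over the ancilla. -/
def traceAncilla {M N : ℕ} (X : Op (M + N)) : Op N :=
  Matrix.of fun n n' => ∑ s : Occ M, X (Fin.append s n) (Fin.append s n')

/-- The state `U (ρ ⊗ ρ_R) U†` after the joint evolution with the ancilla. -/
def entangled {M N : ℕ} (U : Op (M + N)) (ρR : Op M) (ρ : Op N) : Op (M + N) :=
  U * tensor ρR ρ * Uᴴ

/-- The probability `Tr (⟨v|_R X |v⟩_R)` of finding the ancilla in the state `v`. -/
def ancillaProb {M N : ℕ} (v : Fock M) (X : Op (M + N)) : ℝ := (ancillaSandwich v X).trace.re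

/-- The state `⟨v|_R X |v⟩_R / Tr (⟨v|_R X |v⟩_R)` of the system once the ancilla has been found
in the state `v`. -/
def ancillaState {M N : ℕ} (v : Fock M) (X : Op (M + N)) : Op N :=
  ((ancillaProb v X : ℂ)⁻¹) • ancillaSandwich v X

end Fermion

end

/-! Everything rests on how the fermionic partial transpose interacts with multiplication by even
operators. On a Majorana monomial it is the factor `i ^ k_A`. Multiplying two monomials cancels
their common indices in pairs. If one monomial is local to `A`, each cancelled pair removes `i ^ 2 =
-1`, and the resulting sign is exactly the one for exchanging the two monomials when one of them is
even. Hence `(Y X)ᵀ = Xᵀ Yᵀ` and `(X Y)ᵀ = Yᵀ Xᵀ` for even `Y` local to `A` and even `X`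
(`partialTranspose_mul_left`, `partialTranspose_mul_right`), whereas even operators of the
complement are simply pulled out (the `_compl` versions). On even operators of `A` the map also
commutes with the adjoint. So local unitaries and local projections are sent to unitaries and
projections, and the trace is always preserved.

A local measurement of `ρ` thus becomes a pinching of `ρᵀ` by the projections `P_Aᵀ P_B`. These are
still mutually orthogonal, because the trace factorizes over `A` and `B`: a vanishing product forces
one of the two local factors to vanish. The transposed state need not be Hermitian, so the trace
norm is handled through duality, as the maximum of `Re Tr (W X)` over contractions `W`; this yields
the triangle inequality, invariance under unitaries and the pinching bound
`sum_traceNorm_pinching_le`. The passage to averaged negativities is then elementary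
(`sum_negativity_le`); the logarithmic version uses `log x ≤ x - 1`.

For an ancilla, the transpose of `ρ_R ⊗ X` factorizes, and the full transpose of a state is positive
of trace one, so appending a state changes no norm (`IsDensity.traceNorm_partialTranspose_tensor`).
Measuring `R` in a basis of definite parity is a pinching by `|μ⟩⟨μ| ⊗ 1` whose blocks are again
products with an ancilla state, so the same lemma removes the ancilla. Tracing out is the triangle
inequality applied to the sum of the outcomes. -/

noncomputable section

namespace Fermion

open Matrix

/-! ### Contractions and the polar decomposition -/

section TraceNorm

variable {n : Type*} [Fintype n] [DecidableEq n]

/-- A square matrix of operator norm at most `1`. -/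
def IsContraction (W : Matrix n n ℂ) : Prop := (1 - Wᴴ * W).PosSemidef

/-- The defect splits as `1 - (WV)ᴴ(WV) = (1 - VᴴV) + Vᴴ(1 - WᴴW)V`, a sum of positive terms. -/
theorem IsContraction.mul {W V : Matrix n n ℂ} (hW : IsContraction W) (hV : IsContraction V) :
    IsContraction (W * V) := by
  have h := hV.add (hW.conjTranspose_mul_mul_same V)
  unfold IsContraction
  convert h using 1
  rw [conjTranspose_mul]
  noncomm_ring

theorem IsContraction.of_isStarProjection {Q : Matrix n n ℂ} (hQ : IsStarProjection Q) :
    IsContraction Q := by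
  have h1 : Qᴴ = Q := hQ.isSelfAdjoint
  have h2 : Q * Q = Q := hQ.isIdempotentElem
  have h := posSemidef_conjTranspose_mul_self (1 - Q)
  unfold IsContraction
  convert h using 1
  rw [conjTranspose_sub, conjTranspose_one, h1]
  simp only [mul_sub, sub_mul, mul_one, one_mul, h2]
  abel

theorem isContraction_one : IsContraction (1 : Matrix n n ℂ) := by
  simp [IsContraction, PosSemidef.zero]

theorem IsContraction.of_conjTranspose_mul_self_eq_one {U : Matrix n n ℂ} (hU : Uᴴ * U = 1) :
    IsContraction U := by
  simp [IsContraction, hU, PosSemidef.zero]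

/-- Multiplication by a contraction does not increase the trace of a positive operator. -/
theorem IsContraction.re_trace_le {K D : Matrix n n ℂ} (hK : IsContraction K) (hD : D.PosSemidef) :
    (K * D).trace.re ≤ D.trace.re := by
  obtain ⟨B, rfl⟩ := CStarAlgebra.nonneg_iff_eq_star_mul_self.mp hD.nonneg
  rw [star_eq_conjTranspose]
  -- `(1 - KᴴK) + (1 - K)ᴴ(1 - K) = 2 - K - Kᴴ`, so the Hermitian part of a contraction is at most
  -- `1`; conjugating by `B` and taking traces gives the claim.
  have h1 := ((hK.add (posSemidef_conjTranspose_mul_self (1 - K))).mul_mul_conjTranspose_same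
    B).trace_nonneg
  have h2 : B * (1 - Kᴴ * K + (1 - K)ᴴ * (1 - K)) * Bᴴ =
      2 • (B * Bᴴ) - B * K * Bᴴ - (B * K * Bᴴ)ᴴ := by
    simp only [conjTranspose_sub, conjTranspose_one, conjTranspose_mul, conjTranspose_conjTranspose]
    noncomm_ring
  rw [h2, trace_sub, trace_sub, trace_conjTranspose, trace_smul] at h1
  have h3 := (Complex.le_def.1 h1).1
  have e1 : (B * K * Bᴴ).trace = (K * (Bᴴ * B)).trace := by
    rw [trace_mul_comm, ← Matrix.mul_assoc, trace_mul_comm]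
  have e2 : (B * Bᴴ).trace = (Bᴴ * B).trace := trace_mul_comm _ _
  rw [e1, e2] at h3
  simp at h3
  linarith

/-- Polar decomposition: with `P = √(X Xᴴ)` there are contractions `V` and `W` such that `X = P V`
and `Tr (W X) = Tr P`. -/
theorem exists_polar (X : Matrix n n ℂ) :
    ∃ V W : Matrix n n ℂ, IsContraction V ∧ IsContraction W ∧ X = CFC.sqrt (X * Xᴴ) * V ∧
      (W * X).trace = (CFC.sqrt (X * Xᴴ)).trace := by
  have hP : (CFC.sqrt (X * Xᴴ)).PosSemidef := nonneg_iff_posSemidef.1 (CFC.sqrt_nonneg _)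
  have hPP : CFC.sqrt (X * Xᴴ) * CFC.sqrt (X * Xᴴ) = X * Xᴴ :=
    CFC.sqrt_mul_sqrt_self _ (posSemidef_self_mul_conjTranspose X).nonneg
  generalize CFC.sqrt (X * Xᴴ) = P at hP hPP
  -- `G` is the pseudo-inverse of `P`: nonzero eigenvalues are inverted, and the convention `0⁻¹ =
  -- 0` keeps the kernel. Thus `P * G` is the support projection of `P`.
  obtain ⟨G, hG, hPG, hGPP⟩ : ∃ G : Matrix n n ℂ, Gᴴ = G ∧ P * G = G * P ∧ P * G * P = P ∧
      G * P * G = G := by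
    have hs := hP.isHermitian.spectral_theorem
    set U := (hP.isHermitian.eigenvectorUnitary : Matrix n n ℂ) with hU
    have hUU : Uᴴ * U = 1 := Unitary.coe_star_mul_self hP.isHermitian.eigenvectorUnitary
    set d := hP.isHermitian.eigenvalues
    have hs' : P = U * diagonal (fun i => (d i : ℂ)) * Uᴴ := by
      rw [hs, Unitary.conjStarAlgAut_apply]; rfl
    have key : ∀ a b : n → ℂ, (U * diagonal a * Uᴴ) * (U * diagonal b * Uᴴ) =
        U * diagonal (fun i => a i * b i) * Uᴴ := by
      intro a b
      calc _ = U * diagonal a * (Uᴴ * U) * diagonal b * Uᴴ := by simp only [Matrix.mul_assoc]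
        _ = _ := by rw [hUU, Matrix.mul_one, Matrix.mul_assoc U, diagonal_mul_diagonal]
    refine ⟨U * diagonal (fun i => ((d i)⁻¹ : ℂ)) * Uᴴ, ?_, ?_, ?_, ?_⟩
    · rw [conjTranspose_mul, conjTranspose_mul, conjTranspose_conjTranspose,
        diagonal_conjTranspose, ← Matrix.mul_assoc]
      congr; ext i; simp
    · rw [hs', key, key]; congr; ext i; ring
    · rw [hs', key, key]; congr; ext i
      by_cases h : (d i : ℂ) = 0 <;> simp [h]
    · rw [hs', key, key]; congr; ext i
      by_cases h : (d i : ℂ) = 0 <;> simp [h]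
  have hPH : Pᴴ = P := hP.isHermitian
  have hproj : IsStarProjection (P * G) := by
    constructor
    · change P * G * (P * G) = P * G
      rw [← Matrix.mul_assoc, hGPP.1]
    · change (P * G)ᴴ = P * G
      rw [conjTranspose_mul, hG, hPH, hPG]
  have hGG : ∀ Y : Matrix n n ℂ, Y * Yᴴ = P * P → G * (Y * Yᴴ) * G = P * G := by
    intro Y hY
    rw [hY, ← Matrix.mul_assoc, ← hPG, Matrix.mul_assoc (P * G), ← Matrix.mul_assoc, hGPP.1]
  have hpsd : ∀ Q : Matrix n n ℂ, IsStarProjection Q → (1 - Q).PosSemidef := by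
    intro Q hQ
    have h := IsContraction.of_isStarProjection hQ
    rwa [IsContraction, show Qᴴ = Q from hQ.isSelfAdjoint,
      show Q * Q = Q from hQ.isIdempotentElem] at h
  have hGX : P * G * (G * X) = G * X := by
    rw [← Matrix.mul_assoc, hPG, hGPP.2]
  have hXG : (G * X) * (Xᴴ * G) = P * G := by
    rw [← hGG X hPP.symm]; simp only [Matrix.mul_assoc]
  -- `V = G X` is the partial isometry of the polar decomposition and `W` is its adjoint: by `hXG`,
  -- `V Vᴴ` is the support projection of `P`, whence `Vᴴ V` is a projection too.
  refine ⟨G * X, Xᴴ * G, ?_, ?_, ?_, ?_⟩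
  · refine hpsd _ ⟨?_, ?_⟩
    · rw [conjTranspose_mul, hG]
      change Xᴴ * G * (G * X) * (Xᴴ * G * (G * X)) = Xᴴ * G * (G * X)
      calc _ = Xᴴ * G * ((G * X) * (Xᴴ * G) * (G * X)) := by simp only [Matrix.mul_assoc]
        _ = _ := by rw [hXG, hGX]
    · change _ᴴ = _
      rw [conjTranspose_mul, conjTranspose_conjTranspose]
  · unfold IsContraction
    rw [conjTranspose_mul, conjTranspose_conjTranspose, hG, hXG]
    exact hpsd _ hproj
  -- `1 - PG` annihilates `X Xᴴ = P²`, hence it annihilates `X`, which is `X = P (G X)`.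
  · have h0 : (1 - P * G) * X * ((1 - P * G) * X)ᴴ = 0 := by
      have h1 : (1 - P * G) * P = 0 := by rw [sub_mul, one_mul, hGPP.1, sub_self]
      calc _ = (1 - P * G) * (X * Xᴴ) * (1 - P * G)ᴴ := by
            rw [conjTranspose_mul]; simp only [Matrix.mul_assoc]
        _ = 0 := by rw [← hPP, ← Matrix.mul_assoc, h1, Matrix.zero_mul, Matrix.zero_mul]
    have h2 := self_mul_conjTranspose_eq_zero.1 h0
    rw [sub_mul, one_mul, sub_eq_zero, Matrix.mul_assoc] at h2
    exact h2
  · rw [trace_mul_comm, ← Matrix.mul_assoc, ← hPP, Matrix.mul_assoc, hPG, ← Matrix.mul_assoc, hGPP.1]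

end TraceNorm

/-! ### Duality, pinching and averaging for the trace norm -/

section Norm

variable {N : ℕ}

/-- With `X = P V`, cyclicity turns the left side into `Re Tr (V W P)`, where `V W` is a contraction
and `P` is positive. Together with `exists_re_trace_mul_eq_traceNorm` this is the dual description
of the norm. -/
theorem re_trace_mul_le_traceNorm {W : Op N} (hW : IsContraction W) (X : Op N) :
    (W * X).trace.re ≤ traceNorm X := by
  obtain ⟨V, -, hV, -, hX, -⟩ := exists_polar X
  have h := (hV.mul hW).re_trace_le (nonneg_iff_posSemidef.1 (CFC.sqrt_nonneg (X * Xᴴ)))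
  calc (W * X).trace.re = (V * W * CFC.sqrt (X * Xᴴ)).trace.re := by
        conv_lhs => rw [hX]
        rw [← Matrix.mul_assoc, trace_mul_comm, ← Matrix.mul_assoc]
    _ ≤ _ := h

theorem exists_re_trace_mul_eq_traceNorm (X : Op N) :
    ∃ W : Op N, IsContraction W ∧ (W * X).trace.re = traceNorm X := by
  obtain ⟨-, W, -, hW, -, h⟩ := exists_polar X
  exact ⟨W, hW, by rw [h, traceNorm]⟩

theorem re_trace_le_traceNorm (X : Op N) : X.trace.re ≤ traceNorm X := by
  simpa using re_trace_mul_le_traceNorm isContraction_one X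

theorem traceNorm_sum_le {ι : Type*} (s : Finset ι) (X : ι → Op N) :
    traceNorm (∑ μ ∈ s, X μ) ≤ ∑ μ ∈ s, traceNorm (X μ) := by
  obtain ⟨W, hW, h⟩ := exists_re_trace_mul_eq_traceNorm (∑ μ ∈ s, X μ)
  rw [← h, Matrix.mul_sum, trace_sum, Complex.re_sum]
  exact Finset.sum_le_sum fun μ _ => re_trace_mul_le_traceNorm hW _

theorem traceNorm_mul_mul_le {U V : Op N} (hU : IsContraction U) (hV : IsContraction V)
    (X : Op N) : traceNorm (U * X * V) ≤ traceNorm X := by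
  obtain ⟨W, hW, h⟩ := exists_re_trace_mul_eq_traceNorm (U * X * V)
  have e : (W * (U * X * V)).trace = (V * W * U * X).trace := by
    rw [← Matrix.mul_assoc, trace_mul_comm, ← Matrix.mul_assoc, ← Matrix.mul_assoc]
  rw [← h, e]
  exact re_trace_mul_le_traceNorm ((hV.mul hW).mul hU) X

theorem traceNorm_smul {r : ℝ} (hr : 0 ≤ r) (X : Op N) :
    traceNorm ((r : ℂ) • X) = r * traceNorm X := by
  have h : CFC.sqrt (((r : ℂ) • X) * ((r : ℂ) • X)ᴴ) = (r : ℂ) • CFC.sqrt (X * Xᴴ) := by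
    apply CFC.sqrt_unique
    · rw [smul_mul_smul_comm, CFC.sqrt_mul_sqrt_self _ (posSemidef_self_mul_conjTranspose X).nonneg,
        conjTranspose_smul, smul_mul_smul_comm]
      simp
    · exact smul_nonneg (by exact_mod_cast hr) (CFC.sqrt_nonneg _)
  rw [traceNorm, h, trace_smul, traceNorm]
  simp

/-- Pinching: the trace norm dominates the diagonal blocks with respect to mutually orthogonal
projections, together with the trace of the remaining block. -/
theorem sum_traceNorm_pinching_le {ι : Type*} [Fintype ι] {Q : ι → Op N}
    (hQ : ∀ μ, IsStarProjection (Q μ)) (hQQ : ∀ μ ν, μ ≠ ν → Q μ * Q ν = 0) (X : Op N) :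
    ∑ μ, traceNorm (Q μ * X * Q μ) + (X.trace.re - ∑ μ, (Q μ * X * Q μ).trace.re) ≤
      traceNorm X := by
  classical
  have hH : ∀ μ, (Q μ)ᴴ = Q μ := fun μ => (hQ μ).isSelfAdjoint
  have hI : ∀ μ, Q μ * Q μ = Q μ := fun μ => (hQ μ).isIdempotentElem
  choose W hW hWX using fun μ => exists_re_trace_mul_eq_traceNorm (Q μ * X * Q μ)
  have hQS : ∀ μ, Q μ * ∑ ν, Q ν = Q μ := by
    intro μ
    rw [Matrix.mul_sum, Finset.sum_eq_single μ (fun ν _ h => hQQ _ _ h.symm) (by simp), hI]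
  have hSQ : ∀ μ, (∑ ν, Q ν) * Q μ = Q μ := by
    intro μ
    rw [Matrix.sum_mul, Finset.sum_eq_single μ (fun ν _ h => hQQ _ _ h) (by simp), hI]
  set S := ∑ ν, Q ν with hS
  have hSH : Sᴴ = S := by rw [hS, conjTranspose_sum]; simp only [hH]
  have hSS : S * S = S := by
    conv_lhs => rw [hS, Matrix.sum_mul]
    simp only [← hS, hQS]
  -- The test operator joins optimal contractions for the separate blocks and is the identity on the
  -- complement of all `Q μ`; that identity is what produces the leftover trace. Its defect is the
  -- sum of the compressed defects of the `Q μ * W μ`.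
  have hC : IsContraction (∑ μ, Q μ * W μ * Q μ + (1 - S)) := by
    have h := posSemidef_sum Finset.univ (fun μ _ =>
      (((IsContraction.of_isStarProjection (hQ μ)).mul (hW μ)).conjTranspose_mul_mul_same (Q μ)))
    unfold IsContraction
    have e1 : (∑ μ, Q μ * W μ * Q μ)ᴴ * (∑ μ, Q μ * W μ * Q μ) =
        ∑ μ, (Q μ)ᴴ * ((Q μ * W μ)ᴴ * (Q μ * W μ)) * Q μ := by
      rw [conjTranspose_sum, Finset.sum_mul]
      refine Finset.sum_congr rfl fun μ _ => ?_
      rw [Finset.mul_sum, Finset.sum_eq_single μ _ (by simp)]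
      · simp only [conjTranspose_mul, hH]
        simp only [Matrix.mul_assoc]
      · intro ν _ hν
        simp only [conjTranspose_mul, hH]
        calc _ = Q μ * (W μ)ᴴ * (Q μ * Q ν) * W ν * Q ν := by simp only [Matrix.mul_assoc]
          _ = 0 := by rw [hQQ _ _ hν.symm]; simp
    have e3 : (1 - S) * (∑ μ, Q μ * W μ * Q μ) = 0 := by
      rw [sub_mul, one_mul, Matrix.mul_sum, sub_eq_zero]
      exact Finset.sum_congr rfl fun μ _ => by rw [← Matrix.mul_assoc, ← Matrix.mul_assoc, hSQ]
    have e4 : (∑ μ, Q μ * W μ * Q μ)ᴴ * (1 - S) = 0 := by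
      have := congrArg conjTranspose e3
      rwa [conjTranspose_mul, conjTranspose_sub, conjTranspose_one, hSH, conjTranspose_zero] at this
    convert h using 1
    simp only [mul_sub, sub_mul, mul_one, Finset.sum_sub_distrib]
    rw [← e1, conjTranspose_add, conjTranspose_sub, conjTranspose_one, hSH, add_mul, mul_add,
      mul_add, e3, e4]
    simp only [mul_sub, sub_mul, mul_one, one_mul, hSS, hH, hI, ← hS]
    abel
  refine le_trans (le_of_eq ?_) (re_trace_mul_le_traceNorm hC X)
  have e : ∀ (μ) (Y : Op N), (Q μ * Y * Q μ * X).trace = (Y * (Q μ * X * Q μ)).trace := by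
    intro μ Y
    rw [Matrix.mul_assoc, Matrix.mul_assoc, trace_mul_comm, Matrix.mul_assoc, Matrix.mul_assoc]
  have e' : ∀ μ, (Q μ * X * Q μ).trace = (Q μ * X).trace := by
    intro μ
    rw [trace_mul_comm, ← Matrix.mul_assoc, hI]
  rw [add_mul, sub_mul, one_mul, trace_add, trace_sub, hS, Matrix.sum_mul, Matrix.sum_mul,
    trace_sum, trace_sum, Complex.add_re, Complex.sub_re, Complex.re_sum, Complex.re_sum]
  simp only [e, hWX, e']

/-- Averages over measurement outcomes of the negativity and of the logarithmic negativity, in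
terms of the trace norms `t μ` after the measurement and `T` before it. -/
theorem sum_negativity_le {ι : Type*} [Fintype ι] {r t : ι → ℝ} {T : ℝ} (hr : ∀ μ, 0 ≤ r μ)
    (ht : ∀ μ, r μ ≠ 0 → 0 < t μ) (hr1 : ∑ μ, r μ ≤ 1) (hT : 1 ≤ T)
    (h : ∑ μ, r μ * t μ + (1 - ∑ μ, r μ) ≤ T) :
    ∑ μ, r μ * ((t μ - 1) / 2) ≤ (T - 1) / 2 ∧ ∑ μ, r μ * Real.log (t μ) ≤ Real.log T := by
  constructor
  · have : ∑ μ, r μ * ((t μ - 1) / 2) = (∑ μ, r μ * t μ - ∑ μ, r μ) / 2 := by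
      rw [← Finset.sum_sub_distrib, Finset.sum_div]
      exact Finset.sum_congr rfl fun μ _ => by ring
    linarith
  · have hT0 : 0 < T := by linarith
    -- This is `log (t / T) ≤ t / T - 1`, weighted by `r μ`.
    have h1 : ∀ μ ∈ Finset.univ, r μ * Real.log (t μ) ≤ r μ * Real.log T + (r μ * t μ) / T - r μ := by
      intro μ _
      by_cases h0 : r μ = 0
      · simp [h0]
      have h2 := Real.log_le_sub_one_of_pos (div_pos (ht μ h0) hT0)
      rw [Real.log_div (ht μ h0).ne' hT0.ne'] at h2
      have h3 := mul_le_mul_of_nonneg_left h2 (hr μ)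
      have : r μ * t μ / T = r μ * (t μ / T) := by ring
      rw [this]
      linarith
    refine (Finset.sum_le_sum h1).trans ?_
    rw [Finset.sum_sub_distrib, Finset.sum_add_distrib, ← Finset.sum_mul, ← Finset.sum_div]
    have h4 : (∑ μ, r μ * t μ) / T ≤ (T - (1 - ∑ μ, r μ)) / T := by gcongr; linarith
    have h5 : (T - (1 - ∑ μ, r μ)) / T = 1 - (1 - ∑ μ, r μ) * T⁻¹ := by field_simp
    -- The missing probability `1 - ∑ r` contributes `(1 - ∑ r)(1 - 1/T)`, which is absorbed by `(1
    -- - ∑ r) log T`.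
    have h6 := mul_le_mul_of_nonneg_left (Real.one_sub_inv_le_log_of_pos hT0)
      (sub_nonneg.2 hr1)
    rw [h5] at h4
    linarith

end Norm

/-! ### Jordan–Wigner form and the Majorana relations -/

section Pauli

variable {N : ℕ}

/-- The character `n ↦ (-1) ^ ∑_{i ∈ T} n_i` of the group of occupation numbers modulo `2`. -/
def signChar (T : Finset (Fin N)) (n : Occ N) : ℂ := ∏ i ∈ T, (-1) ^ (n i : ℕ)

theorem neg_one_pow_add_fin_two (a b : Fin 2) :
    (-1 : ℂ) ^ ((a + b : Fin 2) : ℕ) = (-1) ^ (a : ℕ) * (-1) ^ (b : ℕ) := by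
  fin_cases a <;> fin_cases b <;> simp

theorem signChar_add (T : Finset (Fin N)) (n m : Occ N) :
    signChar T (n + m) = signChar T n * signChar T m := by
  simp only [signChar, Pi.add_apply, neg_one_pow_add_fin_two, Finset.prod_mul_distrib]

theorem signChar_single (T : Finset (Fin N)) (j : Fin N) :
    signChar T (Pi.single j 1) = if j ∈ T then -1 else 1 := by
  have h : ∀ i ∈ T, (-1 : ℂ) ^ ((Pi.single j 1 : Occ N) i : ℕ) = if i = j then -1 else 1 := by
    intro i _
    by_cases hij : i = j
    · subst hij; simp
    · simp [hij]
  rw [signChar, Finset.prod_congr rfl h, Finset.prod_ite_eq']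

theorem signChar_mul_self (T : Finset (Fin N)) (n : Occ N) :
    signChar T n * signChar T n = 1 := by
  rw [signChar, ← Finset.prod_mul_distrib]
  exact Finset.prod_eq_one fun i _ => by rw [← pow_add]; exact Even.neg_one_pow ⟨_, rfl⟩

theorem star_signChar (T : Finset (Fin N)) (n : Occ N) : star (signChar T n) = signChar T n := by
  simp [signChar]

/-- The Pauli string `|n⟩ ↦ (-1) ^ (∑_{i ∈ T} n_i) |n + e⟩`. -/
def pauli (e : Occ N) (T : Finset (Fin N)) : Op N :=
  Matrix.of fun n' n => if n' = n + e then signChar T n else 0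

theorem occ_add_self (e : Occ N) : e + e = 0 := by
  ext i; simp only [Pi.add_apply, Pi.zero_apply]; generalize e i = a; fin_cases a <;> rfl

theorem pauli_mul_pauli (e e' : Occ N) (T T' : Finset (Fin N)) :
    pauli e T * pauli e' T' =
      signChar T e' • Matrix.of fun n' n =>
        if n' = n + (e + e') then signChar T n * signChar T' n else 0 := by
  ext n' n
  rw [mul_apply, Finset.sum_eq_single (n + e')]
  · simp only [pauli, of_apply, Matrix.smul_apply, smul_eq_mul, signChar_add, if_true,
      add_comm e e', ← add_assoc]
    split_ifs
    · ring
    · simp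
  · intro b _ hb
    simp [pauli, hb]
  · simp

theorem pauli_comm (e e' : Occ N) (T T' : Finset (Fin N)) :
    pauli e T * pauli e' T' = (signChar T e' * signChar T' e) • (pauli e' T' * pauli e T) := by
  rw [pauli_mul_pauli, pauli_mul_pauli, smul_smul, mul_assoc, signChar_mul_self, mul_one]
  congr; ext n' n; rw [add_comm e e', mul_comm]

theorem pauli_mul_self (e : Occ N) (T : Finset (Fin N)) :
    pauli e T * pauli e T = signChar T e • (1 : Op N) := by
  rw [pauli_mul_pauli]
  congr; ext n' n
  simp [occ_add_self, signChar_mul_self, one_apply]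

theorem pauli_conjTranspose (e : Occ N) (T : Finset (Fin N)) :
    (pauli e T)ᴴ = signChar T e • pauli e T := by
  ext n' n
  have h : n = n' + e ↔ n' = n + e := by
    constructor <;> rintro rfl <;> rw [add_assoc, occ_add_self, add_zero]
  by_cases h1 : n' = n + e
  · have h2 := h.2 h1
    simp only [pauli, conjTranspose_apply, of_apply, Matrix.smul_apply, if_pos h1, if_pos h2,
      star_signChar, smul_eq_mul]
    rw [h1, signChar_add, mul_comm]
  · simp [pauli, h, h1]

/-- The sites carrying the sign of the Majorana operator `k` in its Jordan-Wigner form. -/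
def signSites (k : Fin (N * 2)) : Finset (Fin N) :=
  Finset.univ.filter fun i => i < k.divNat ∨ (i = k.divNat ∧ k.modNat ≠ 0)

theorem annihilation_apply (j : Fin N) (n' n : Occ N) :
    annihilation j n' n = if n j = 1 ∧ n' = n + Pi.single j 1 then
      signChar (Finset.univ.filter (· < j)) n else 0 := by
  have h : n j = 1 → Function.update n j 0 = n + Pi.single j 1 := by
    intro h1
    ext i
    by_cases hi : i = j
    · subst hi; simp [h1]
    · simp [hi]
  simp only [annihilation, of_apply, signChar, Finset.prod_pow_eq_pow_sum]
  congr 1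
  exact propext (and_congr_right fun h1 => by rw [h h1])

theorem creation_apply (j : Fin N) (n' n : Occ N) :
    creation j n' n = if n j = 0 ∧ n' = n + Pi.single j 1 then
      signChar (Finset.univ.filter (· < j)) n else 0 := by
  rw [creation, conjTranspose_apply, annihilation_apply]
  have h : n = n' + Pi.single j 1 ↔ n' = n + Pi.single j 1 := by
    constructor <;> rintro rfl <;> rw [add_assoc, occ_add_self, add_zero]
  simp only [h]
  by_cases h1 : n' = n + Pi.single j 1
  · have h2 : n' j = 1 ↔ n j = 0 := by
      rw [h1, Pi.add_apply, Pi.single_eq_same]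
      generalize n j = a
      fin_cases a <;> simp
    simp only [h2]
    simp only [h1, and_true]
    split_ifs
    · rw [star_signChar, signChar_add, signChar_single]; simp
    · simp
  · simp [h1]

/-- The Jordan-Wigner form of the Majorana operators. -/
theorem majorana_eq_pauli (k : Fin (N * 2)) :
    majorana k = (if k.modNat = 0 then 1 else -Complex.I) •
      pauli (Pi.single k.divNat 1) (signSites k) := by
  ext n' n
  by_cases h : k.modNat = 0
  · have hT : signSites k = Finset.univ.filter (· < k.divNat) := by simp [signSites, h]
    simp only [majorana, h, if_true, one_smul, Matrix.add_apply, creation_apply,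
      annihilation_apply, pauli, of_apply, hT]
    generalize n k.divNat = a
    fin_cases a <;> simp
  · have hT : signSites k = insert k.divNat (Finset.univ.filter (· < k.divNat)) := by
      ext i; simp [signSites, h, or_comm]
    have hS : signChar (signSites k) n =
        (-1) ^ (n k.divNat : ℕ) * signChar (Finset.univ.filter (· < k.divNat)) n := by
      rw [hT, signChar, Finset.prod_insert (by simp), signChar]
    simp only [majorana, h, if_false, Matrix.smul_apply, Matrix.sub_apply, creation_apply,
      annihilation_apply, pauli, of_apply, hS]
    generalize n k.divNat = a
    fin_cases a
    all_goals simp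
    all_goals split_ifs <;> simp

theorem parity_eq_pauli : parity N = pauli 0 Finset.univ := by
  ext n' n
  simp only [parity, pauli, diagonal_apply, of_apply, signChar, add_zero, Finset.prod_pow_eq_pow_sum]
  split_ifs with h <;> simp [h]

theorem majorana_mul_self (k : Fin (N * 2)) : majorana k * majorana k = 1 := by
  rw [majorana_eq_pauli, smul_mul_smul_comm, pauli_mul_self, signChar_single, smul_smul]
  by_cases h : k.modNat = 0 <;> simp [h, signSites]

theorem majorana_conjTranspose (k : Fin (N * 2)) : (majorana k)ᴴ = majorana k := by
  rw [majorana_eq_pauli, conjTranspose_smul, pauli_conjTranspose, signChar_single, smul_smul]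
  by_cases h : k.modNat = 0 <;> simp [h, signSites]

theorem majorana_mul_majorana {k l : Fin (N * 2)} (h : k ≠ l) :
    majorana k * majorana l = -(majorana l * majorana k) := by
  rw [majorana_eq_pauli, majorana_eq_pauli, smul_mul_smul_comm, smul_mul_smul_comm, pauli_comm,
    smul_smul, signChar_single, signChar_single, ← neg_smul]
  congr 1
  have hd : k.divNat = l.divNat → (k.modNat = 0 ↔ ¬ l.modNat = 0) := by
    intro h1
    have h2 := congrArg Fin.val h1
    simp only [Fin.coe_divNat, Fin.ext_iff, Fin.coe_modNat, Fin.val_zero] at h2 ⊢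
    have h3 : (k : ℕ) ≠ l := fun h' => h (Fin.ext h')
    omega
  -- Exactly one of the two memberships holds: the sign string of the later mode covers the earlier
  -- mode, and within one mode only the second Majorana operator carries the sign of its own site.
  have hs : (if l.divNat ∈ signSites k then (-1 : ℂ) else 1) *
      (if k.divNat ∈ signSites l then -1 else 1) = -1 := by
    simp only [signSites, Finset.mem_filter, Finset.mem_univ, true_and]
    rcases lt_trichotomy k.divNat l.divNat with h1 | h1 | h1
    · simp [h1, h1.not_gt, h1.ne, h1.ne']
    · by_cases h2 : l.modNat = 0 <;> simp [h1, h2, hd h1]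
    · simp [h1, h1.not_gt, h1.ne, h1.ne']
  rw [hs]
  ring

theorem parity_mul_majorana (k : Fin (N * 2)) :
    parity N * majorana k = -(majorana k * parity N) := by
  rw [parity_eq_pauli, majorana_eq_pauli, mul_smul_comm, smul_mul_assoc, pauli_comm,
    signChar_single]
  simp [signChar]

theorem parity_mul_self : parity N * parity N = 1 := by
  rw [parity_eq_pauli, pauli_mul_self]; simp [signChar]

end Pauli

/-! ### The basis of Majorana monomials and the even local operators -/

section Monomials

variable {N : ℕ}

/-- Equality up to a sign. -/
def SignEq (X Y : Op N) : Prop := X = Y ∨ X = -Y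

theorem SignEq.refl (X : Op N) : SignEq X X := Or.inl rfl

theorem SignEq.symm {X Y : Op N} (h : SignEq X Y) : SignEq Y X := by
  rcases h with h | h
  · exact Or.inl h.symm
  · exact Or.inr (by rw [h, neg_neg])

theorem SignEq.trans {X Y Z : Op N} (h : SignEq X Y) (h' : SignEq Y Z) : SignEq X Z := by
  rcases h with rfl | rfl <;> rcases h' with rfl | rfl
  · exact Or.inl rfl
  · exact Or.inr rfl
  · exact Or.inr rfl
  · exact Or.inl (neg_neg _)

theorem SignEq.mul {X Y X' Y' : Op N} (h : SignEq X Y) (h' : SignEq X' Y') :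
    SignEq (X * X') (Y * Y') := by
  rcases h with rfl | rfl <;> rcases h' with rfl | rfl <;> simp [SignEq]

theorem SignEq.mem_iff {X Y : Op N} (h : SignEq X Y) (p : Submodule ℂ (Op N)) :
    X ∈ p ↔ Y ∈ p := by
  rcases h with rfl | rfl <;> simp

/-- The product of the Majorana operators in a list. -/
def majoranaProd (l : List (Fin (N * 2))) : Op N := (l.map majorana).prod

@[simp] theorem majoranaProd_nil : majoranaProd ([] : List (Fin (N * 2))) = 1 := rfl

@[simp] theorem majoranaProd_cons (k : Fin (N * 2)) (l : List (Fin (N * 2))) :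
    majoranaProd (k :: l) = majorana k * majoranaProd l := by simp [majoranaProd]

theorem majoranaProd_append (l l' : List (Fin (N * 2))) :
    majoranaProd (l ++ l') = majoranaProd l * majoranaProd l' := by simp [majoranaProd]

theorem monomial_eq_majoranaProd (S : Finset (Fin (N * 2))) :
    monomial S = majoranaProd (S.sort (· ≤ ·)) := rfl

/-- Reordering signs can be left undetermined, since the partial transpose scales a monomial by a
factor that depends on its index set only. -/
theorem signEq_majoranaProd_of_perm {l l' : List (Fin (N * 2))} (h : l.Perm l') :
    SignEq (majoranaProd l) (majoranaProd l') := by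
  induction h with
  | nil => exact .refl _
  | cons x _ ih => simpa using (SignEq.refl (majorana x)).mul ih
  | swap x y l =>
    simp only [majoranaProd_cons, ← Matrix.mul_assoc]
    refine SignEq.mul ?_ (.refl _)
    by_cases hxy : x = y
    · subst hxy; exact .refl _
    · exact Or.inr (majorana_mul_majorana (Ne.symm hxy))
  | trans _ _ h1 h2 => exact h1.trans h2

theorem signEq_majoranaProd {l : List (Fin (N * 2))} (h : l.Nodup) :
    SignEq (majoranaProd l) (monomial l.toFinset) := by
  refine signEq_majoranaProd_of_perm ?_
  rw [List.perm_ext_iff_of_nodup h (Finset.sort_nodup _ _)]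
  simp

theorem signEq_majorana_mul_monomial (k : Fin (N * 2)) (S : Finset (Fin (N * 2))) :
    SignEq (majorana k * monomial S) (monomial (symmDiff {k} S)) := by
  by_cases hk : k ∈ S
  · have h1 : symmDiff {k} S = S.erase k := by
      ext x; by_cases hx : x = k <;> simp [Finset.mem_symmDiff, hx, hk]
    have h2 : SignEq (monomial S) (majoranaProd (k :: (S.erase k).sort (· ≤ ·))) := by
      refine signEq_majoranaProd_of_perm ?_
      rw [List.perm_ext_iff_of_nodup (Finset.sort_nodup _ _) (by simp)]
      intro x; by_cases hx : x = k <;> simp [hx, hk]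
    have h3 := (SignEq.refl (majorana k)).mul h2
    rw [majoranaProd_cons, ← Matrix.mul_assoc, majorana_mul_self, Matrix.one_mul] at h3
    rwa [h1]
  · have h1 : symmDiff {k} S = (k :: S.sort (· ≤ ·)).toFinset := by
      ext x; by_cases hx : x = k <;> simp [Finset.mem_symmDiff, hx, hk]
    rw [h1, monomial_eq_majoranaProd, ← majoranaProd_cons]
    exact signEq_majoranaProd (by simp [hk])

theorem signEq_monomial_mul_monomial (S S' : Finset (Fin (N * 2))) :
    SignEq (monomial S * monomial S') (monomial (symmDiff S S')) := by
  have key : ∀ l : List (Fin (N * 2)), l.Nodup →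
      SignEq (majoranaProd l * monomial S') (monomial (symmDiff l.toFinset S')) := by
    intro l hl
    induction l with
    | nil =>
      rw [majoranaProd_nil, Matrix.one_mul, List.toFinset_nil, ← Finset.bot_eq_empty, bot_symmDiff]
      exact .refl _
    | cons k l ih =>
      have h1 : (k :: l).toFinset = symmDiff {k} l.toFinset := by
        have := (List.nodup_cons.1 hl).1
        ext x; by_cases hx : x = k <;> simp [Finset.mem_symmDiff, hx, this]
      rw [h1, symmDiff_assoc, majoranaProd_cons, Matrix.mul_assoc]
      exact ((SignEq.refl _).mul (ih (List.nodup_cons.1 hl).2)).trans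
        (signEq_majorana_mul_monomial _ _)
  have h := key _ (Finset.sort_nodup S (· ≤ ·))
  rwa [Finset.sort_toFinset] at h

theorem majorana_mul_majoranaProd (k : Fin (N * 2)) (l : List (Fin (N * 2))) :
    majorana k * majoranaProd l =
      (-1 : ℂ) ^ (l.countP (· ≠ k)) • (majoranaProd l * majorana k) := by
  induction l with
  | nil => simp
  | cons x l ih =>
    by_cases hx : x = k
    · subst hx
      simp only [majoranaProd_cons, Matrix.mul_assoc]
      rw [ih]
      simp
    · rw [majoranaProd_cons, ← Matrix.mul_assoc, majorana_mul_majorana (Ne.symm hx),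
        List.countP_cons_of_pos (by simpa using hx), Matrix.neg_mul, Matrix.mul_assoc, ih, pow_succ]
      simp [Matrix.mul_assoc]

theorem parity_mul_majoranaProd (l : List (Fin (N * 2))) :
    parity N * majoranaProd l = (-1 : ℂ) ^ l.length • (majoranaProd l * parity N) := by
  induction l with
  | nil => simp
  | cons x l ih =>
    rw [majoranaProd_cons, ← Matrix.mul_assoc, parity_mul_majorana, Matrix.neg_mul,
      Matrix.mul_assoc, ih, List.length_cons, pow_succ]
    simp [Matrix.mul_assoc]

theorem parity_mul_monomial (S : Finset (Fin (N * 2))) :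
    parity N * monomial S = (-1 : ℂ) ^ S.card • (monomial S * parity N) := by
  rw [monomial_eq_majoranaProd, parity_mul_majoranaProd, Finset.length_sort]

theorem majorana_mul_monomial (k : Fin (N * 2)) {S : Finset (Fin (N * 2))} (hS : Even S.card) :
    majorana k * monomial S = if k ∈ S then -(monomial S * majorana k)
      else monomial S * majorana k := by
  have h : (S.sort (· ≤ ·)).countP (· ≠ k) = (S.erase k).card := by
    rw [List.countP_eq_length_filter, ← List.toFinset_card_of_nodup
      ((Finset.sort_nodup S _).filter _)]
    congr 1; ext x; simp [and_comm]
  rw [monomial_eq_majoranaProd, majorana_mul_majoranaProd, h]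
  split_ifs with hk
  · have : Odd (S.erase k).card := by
      have := Finset.card_erase_add_one hk
      rw [← this] at hS
      exact Nat.not_even_iff_odd.1 fun h' => (Nat.even_add_one.1 hS) h'
    rw [this.neg_one_pow]; simp
  · rw [Finset.erase_eq_of_notMem hk, hS.neg_one_pow, one_smul]

/-- A Majorana operator passing an even monomial picks up `-1` exactly when it occurs in it. Here
the sign must be exact, because it has to match the powers of `i`. -/
theorem monomial_mul_monomial_comm (S : Finset (Fin (N * 2))) {S' : Finset (Fin (N * 2))}
    (hS' : Even S'.card) :
    monomial S * monomial S' = (-1 : ℂ) ^ (S ∩ S').card • (monomial S' * monomial S) := by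
  have key : ∀ l : List (Fin (N * 2)), majoranaProd l * monomial S' =
      (-1 : ℂ) ^ (l.countP (· ∈ S')) • (monomial S' * majoranaProd l) := by
    intro l
    induction l with
    | nil => simp
    | cons k l ih =>
      rw [majoranaProd_cons, Matrix.mul_assoc, ih, Matrix.mul_smul, ← Matrix.mul_assoc,
        majorana_mul_monomial k hS']
      by_cases hk : k ∈ S'
      · rw [List.countP_cons_of_pos (by simpa using hk), pow_succ, if_pos hk]
        simp [Matrix.mul_assoc]
      · rw [List.countP_cons_of_neg (by simpa using hk), if_neg hk, Matrix.mul_assoc]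
  have h : (S.sort (· ≤ ·)).countP (· ∈ S') = (S ∩ S').card := by
    rw [List.countP_eq_length_filter, ← List.toFinset_card_of_nodup
      ((Finset.sort_nodup S _).filter _)]
    congr 1; ext x; simp
  rw [monomial_eq_majoranaProd, key, h]

theorem majoranaProd_mul_reverse (l : List (Fin (N * 2))) :
    majoranaProd l * majoranaProd l.reverse = 1 := by
  induction l with
  | nil => simp
  | cons k l ih =>
    rw [List.reverse_cons, majoranaProd_append, majoranaProd_cons, Matrix.mul_assoc,
      ← Matrix.mul_assoc (majoranaProd l), ih]
    simp [majorana_mul_self]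

theorem majoranaProd_conjTranspose (l : List (Fin (N * 2))) :
    (majoranaProd l)ᴴ = majoranaProd l.reverse := by
  induction l with
  | nil => simp
  | cons k l ih =>
    rw [List.reverse_cons, majoranaProd_append, majoranaProd_cons, conjTranspose_mul, ih,
      majorana_conjTranspose]
    simp

theorem monomial_conjTranspose_mul_self (S : Finset (Fin (N * 2))) :
    (monomial S)ᴴ * monomial S = 1 := by
  rw [mul_eq_one_comm, monomial_eq_majoranaProd, majoranaProd_conjTranspose,
    majoranaProd_mul_reverse]

theorem signEq_monomial_conjTranspose (S : Finset (Fin (N * 2))) :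
    SignEq (monomial S)ᴴ (monomial S) := by
  rw [monomial_eq_majoranaProd, majoranaProd_conjTranspose]
  exact signEq_majoranaProd_of_perm (List.reverse_perm _)

@[simp] theorem monomial_empty : monomial (∅ : Finset (Fin (N * 2))) = 1 := by
  simp [monomial]

@[simp] theorem monomial_singleton (k : Fin (N * 2)) : monomial {k} = majorana k := by
  simp [monomial]

theorem trace_one_op : (1 : Op N).trace = 2 ^ N := by simp

theorem trace_eq_zero_of_anticomm {X C : Op N} (hC : C * C = 1) (h : C * X = -(X * C)) :
    X.trace = 0 := by
  have h1 : X = -(C * X * C) := by rw [h, Matrix.neg_mul, neg_neg, Matrix.mul_assoc, hC, mul_one]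
  have h2 : (C * X * C).trace = X.trace := by
    rw [trace_mul_comm, ← Matrix.mul_assoc, hC, one_mul]
  have h3 := congrArg trace h1
  rw [trace_neg, h2] at h3
  linear_combination h3 / 2

/-- An even monomial anticommutes with each of its own factors, an odd one with the parity; both are
involutions. -/
theorem trace_monomial {S : Finset (Fin (N * 2))} (hS : S ≠ ∅) : (monomial S).trace = 0 := by
  by_cases h : Even S.card
  · obtain ⟨k, hk⟩ := Finset.nonempty_iff_ne_empty.2 hS
    refine trace_eq_zero_of_anticomm (majorana_mul_self k) ?_
    rw [majorana_mul_monomial k h, if_pos hk]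
  · refine trace_eq_zero_of_anticomm parity_mul_self ?_
    rw [parity_mul_monomial, (Nat.not_even_iff_odd.1 h).neg_one_pow, neg_one_smul]

theorem coeff_monomial (S S' : Finset (Fin (N * 2))) :
    coeff (monomial S') S = if S = S' then 1 else 0 := by
  rw [coeff]
  split_ifs with h
  · rw [h, monomial_conjTranspose_mul_self, trace_one_op]; field_simp
  · have h1 : symmDiff S S' ≠ ∅ := by simpa using h
    have h2 := ((signEq_monomial_conjTranspose S).mul (.refl (monomial S'))).trans
      (signEq_monomial_mul_monomial S S')
    rcases h2 with h2 | h2 <;> simp [h2, trace_monomial h1]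

/-- The coefficient functional of a Majorana monomial. -/
def coeffLinear (S : Finset (Fin (N * 2))) : Op N →ₗ[ℂ] ℂ where
  toFun X := coeff X S
  map_add' X Y := by simp [coeff, mul_add, add_div]
  map_smul' c X := by simp [coeff, mul_div_assoc]

@[simp] theorem coeffLinear_apply (S : Finset (Fin (N * 2))) (X : Op N) :
    coeffLinear S X = coeff X S := rfl

theorem linearIndependent_monomial :
    LinearIndependent ℂ (monomial : Finset (Fin (N * 2)) → Op N) := by
  rw [Fintype.linearIndependent_iff]
  intro g hg S
  have h := congrArg (coeffLinear S) hg
  rw [map_zero] at h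
  simpa [coeff_monomial] using h

/-- There are `2 ^ (2N)` independent monomials, which is the dimension of the operator space. -/
theorem span_monomial : Submodule.span ℂ (Set.range (monomial : Finset (Fin (N * 2)) → Op N)) = ⊤ :=
  linearIndependent_monomial.span_eq_top_of_card_eq_finrank (by
    simp [Module.finrank_matrix, pow_mul, mul_comm N 2, ← mul_pow]; )

theorem sum_coeff_smul_monomial (X : Op N) : ∑ S, coeff X S • monomial S = X := by
  have h : (∑ S, (coeffLinear S).smulRight (monomial S)) = (LinearMap.id : Op N →ₗ[ℂ] Op N) := by
    refine LinearMap.ext_on_range span_monomial fun S' => ?_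
    simp [coeff_monomial]
  simpa using congrArg (fun f => f X) h

/-- The span of the even Majorana monomials local to the modes in `A`. -/
def evenSpan (A : Finset (Fin N)) : Submodule ℂ (Op N) :=
  Submodule.span ℂ (monomial '' {S | Even S.card ∧ ∀ k ∈ S, k.divNat ∈ A})

theorem monomial_mem_evenSpan {A : Finset (Fin N)} {S : Finset (Fin (N * 2))} (hS : Even S.card)
    (hA : ∀ k ∈ S, k.divNat ∈ A) : monomial S ∈ evenSpan A :=
  Submodule.subset_span ⟨S, ⟨hS, hA⟩, rfl⟩

/-- Products of local monomials are local monomials up to sign, so their span contains the generated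
algebra, and the functional for a nonlocal `S` vanishes on that span. -/
theorem coeff_eq_zero_of_mem_localAlgebra {A : Finset (Fin N)} {X : Op N}
    (hX : X ∈ localAlgebra A) {S : Finset (Fin (N * 2))} (hS : ¬∀ k ∈ S, k.divNat ∈ A) :
    coeff X S = 0 := by
  have h : X ∈ Submodule.span ℂ (monomial '' {S | ∀ k ∈ S, k.divNat ∈ A}) := by
    induction hX using Algebra.adjoin_induction with
    | mem x hx =>
      obtain ⟨k, hk, rfl⟩ := hx
      exact Submodule.subset_span ⟨{k}, by simpa using hk, by simp⟩
    | algebraMap r =>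
      rw [Algebra.algebraMap_eq_smul_one]
      exact Submodule.smul_mem _ _ (Submodule.subset_span ⟨∅, by simp, by simp⟩)
    | add x y _ _ hx hy => exact Submodule.add_mem _ hx hy
    | mul x y _ _ hx hy =>
      have h := Submodule.mul_mem_mul hx hy
      rw [Submodule.span_mul_span] at h
      refine Submodule.span_le.2 ?_ h
      rintro _ ⟨_, ⟨S, hS, rfl⟩, _, ⟨S', hS', rfl⟩, rfl⟩
      refine ((signEq_monomial_mul_monomial S S').mem_iff _).2 (Submodule.subset_span ⟨_, ?_, rfl⟩)
      intro k hk
      rcases Finset.mem_symmDiff.1 hk with h | h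
      · exact hS k h.1
      · exact hS' k h.1
  have h2 : Submodule.span ℂ (monomial '' {S | ∀ k ∈ S, k.divNat ∈ A}) ≤
      LinearMap.ker (coeffLinear S) := by
    refine Submodule.span_le.2 ?_
    rintro _ ⟨S', hS', rfl⟩
    simp only [SetLike.mem_coe, LinearMap.mem_ker, coeffLinear_apply, coeff_monomial]
    rw [if_neg]
    rintro rfl
    exact hS hS'
  exact h2 h

theorem coeff_eq_zero_of_isPhysical {X : Op N} (hX : IsPhysical X) {S : Finset (Fin (N * 2))}
    (hS : ¬Even S.card) : coeff X S = 0 := by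
  have h1 : parity N * (monomial S)ᴴ = -((monomial S)ᴴ * parity N) := by
    have h := parity_mul_monomial S
    rw [(Nat.not_even_iff_odd.1 hS).neg_one_pow, neg_one_smul] at h
    rcases signEq_monomial_conjTranspose S with h' | h' <;> simp [h', h]
  have h2 : parity N * X = X * parity N := by
    conv_rhs => rw [← hX]
    rw [Matrix.mul_assoc _ (parity N), parity_mul_self, mul_one]
  rw [coeff, trace_eq_zero_of_anticomm parity_mul_self, zero_div]
  rw [← Matrix.mul_assoc, h1, Matrix.neg_mul, Matrix.mul_assoc, h2, Matrix.mul_assoc]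

theorem mem_evenSpan_of_coeff {A : Finset (Fin N)} {X : Op N}
    (h : ∀ S, ¬(Even S.card ∧ ∀ k ∈ S, k.divNat ∈ A) → coeff X S = 0) : X ∈ evenSpan A := by
  rw [← sum_coeff_smul_monomial X]
  refine Submodule.sum_mem _ fun S _ => ?_
  by_cases hS : Even S.card ∧ ∀ k ∈ S, k.divNat ∈ A
  · exact Submodule.smul_mem _ _ (monomial_mem_evenSpan hS.1 hS.2)
  · rw [h S hS, zero_smul]; exact Submodule.zero_mem _

theorem IsLocalPhysical.mem_evenSpan {A : Finset (Fin N)} {X : Op N} (h : IsLocalPhysical A X) :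
    X ∈ evenSpan A := by
  refine mem_evenSpan_of_coeff fun S hS => ?_
  by_cases h1 : Even S.card
  · exact coeff_eq_zero_of_mem_localAlgebra h.1 fun h2 => hS ⟨h1, h2⟩
  · exact coeff_eq_zero_of_isPhysical h.2 h1

theorem IsPhysical.mem_evenSpan {X : Op N} (h : IsPhysical X) : X ∈ evenSpan Finset.univ :=
  mem_evenSpan_of_coeff fun _ hS => coeff_eq_zero_of_isPhysical h fun h1 => hS ⟨h1, by simp⟩

theorem evenSpan_mono {A B : Finset (Fin N)} (h : A ⊆ B) : evenSpan A ≤ evenSpan B :=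
  Submodule.span_mono (Set.image_mono fun _ hS => ⟨hS.1, fun k hk => h (hS.2 k hk)⟩)

theorem card_symmDiff_add {α : Type*} [DecidableEq α] (S S' : Finset α) :
    (symmDiff S S').card + 2 * (S ∩ S').card = S.card + S'.card := by
  have h1 := Finset.card_sdiff_add_card_inter S S'
  have h2 := Finset.card_sdiff_add_card_inter S' S
  have h3 : (symmDiff S S').card = (S \ S').card + (S' \ S).card := by
    rw [symmDiff, Finset.sup_eq_union, Finset.card_union_of_disjoint disjoint_sdiff_sdiff]
  rw [Finset.inter_comm] at h2
  omega

theorem mul_mem_evenSpan {A : Finset (Fin N)} {X Y : Op N} (hX : X ∈ evenSpan A)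
    (hY : Y ∈ evenSpan A) : X * Y ∈ evenSpan A := by
  have h := Submodule.mul_mem_mul hX hY
  rw [evenSpan, Submodule.span_mul_span] at h
  refine Submodule.span_le.2 ?_ h
  rintro _ ⟨_, ⟨S, hS, rfl⟩, _, ⟨S', hS', rfl⟩, rfl⟩
  refine ((signEq_monomial_mul_monomial S S').mem_iff _).2 (monomial_mem_evenSpan ?_ ?_)
  · have h1 := card_symmDiff_add S S'
    have := hS.1.add hS'.1
    rw [← h1] at this
    simpa [Nat.even_add] using this
  · intro k hk
    rcases Finset.mem_symmDiff.1 hk with h | h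
    · exact hS.2 k h.1
    · exact hS'.2 k h.1

theorem isPhysical_of_mem_evenSpan {A : Finset (Fin N)} {X : Op N} (hX : X ∈ evenSpan A) :
    IsPhysical X := by
  induction hX using Submodule.span_induction with
  | mem x hx =>
    obtain ⟨S, hS, rfl⟩ := hx
    rw [IsPhysical, parity_mul_monomial, hS.1.neg_one_pow, one_smul, Matrix.mul_assoc,
      parity_mul_self, mul_one]
  | zero => simp [IsPhysical]
  | add x y _ _ hx hy => rw [IsPhysical, mul_add, add_mul, hx, hy]
  | smul a x _ hx => rw [IsPhysical, Matrix.mul_smul, Matrix.smul_mul, hx]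

end Monomials

/-! ### Algebraic rules for the partial transpose -/

section PartialTranspose

variable {N : ℕ} (A : Finset (Fin N))

/-- The number of Majorana operators of `A` in a monomial. -/
def countIn (S : Finset (Fin (N * 2))) : ℕ := (S.filter fun k => k.divNat ∈ A).card

/-- The partial transpose as a linear map. -/
def partialTransposeLinear : Op N →ₗ[ℂ] Op N :=
  ∑ S : Finset (Fin (N * 2)), Complex.I ^ countIn A S • (coeffLinear S).smulRight (monomial S)

theorem partialTransposeLinear_apply (X : Op N) :
    partialTransposeLinear A X = partialTranspose A X := by
  simp [partialTransposeLinear, partialTranspose, countIn, smul_smul, mul_comm]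

theorem partialTranspose_add (X Y : Op N) :
    partialTranspose A (X + Y) = partialTranspose A X + partialTranspose A Y := by
  simp only [← partialTransposeLinear_apply, map_add]

theorem partialTranspose_smul (c : ℂ) (X : Op N) :
    partialTranspose A (c • X) = c • partialTranspose A X := by
  simp only [← partialTransposeLinear_apply, map_smul]

theorem partialTranspose_zero : partialTranspose A 0 = 0 := by
  simp only [← partialTransposeLinear_apply, map_zero]

theorem partialTranspose_sum {ι : Type*} (s : Finset ι) (X : ι → Op N) :
    partialTranspose A (∑ μ ∈ s, X μ) = ∑ μ ∈ s, partialTranspose A (X μ) := by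
  simp only [← partialTransposeLinear_apply, map_sum]

theorem partialTranspose_monomial (S : Finset (Fin (N * 2))) :
    partialTranspose A (monomial S) = Complex.I ^ countIn A S • monomial S := by
  simp [partialTranspose, coeff_monomial, countIn]

theorem partialTranspose_of_signEq {X : Op N} {S : Finset (Fin (N * 2))}
    (h : SignEq X (monomial S)) : partialTranspose A X = Complex.I ^ countIn A S • X := by
  rcases h with rfl | rfl
  · exact partialTranspose_monomial A S
  · rw [← neg_one_smul ℂ, partialTranspose_smul, partialTranspose_monomial, smul_comm]

theorem partialTranspose_one : partialTranspose A (1 : Op N) = 1 := by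
  rw [← monomial_empty, partialTranspose_monomial]; simp [countIn]

theorem trace_partialTranspose (X : Op N) : (partialTranspose A X).trace = X.trace := by
  conv_rhs => rw [← sum_coeff_smul_monomial X]
  rw [partialTranspose, trace_sum, trace_sum]
  refine Finset.sum_congr rfl fun S _ => ?_
  by_cases hS : S = ∅
  · simp [hS]
  · simp [trace_monomial hS]

variable {A}

theorem partialTranspose_mem_evenSpan {B : Finset (Fin N)} {X : Op N} (hX : X ∈ evenSpan B) :
    partialTranspose A X ∈ evenSpan B := by
  induction hX using Submodule.span_induction with
  | mem x hx =>
    obtain ⟨S, hS, rfl⟩ := hx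
    rw [partialTranspose_monomial]
    exact Submodule.smul_mem _ _ (monomial_mem_evenSpan hS.1 hS.2)
  | zero => rw [partialTranspose_zero]; exact Submodule.zero_mem _
  | add x y _ _ hx hy => rw [partialTranspose_add]; exact Submodule.add_mem _ hx hy
  | smul a x _ hx => rw [partialTranspose_smul]; exact Submodule.smul_mem _ _ hx

/-- Reduces the product rules to pairs of monomials. -/
theorem bilinear_eq_of_span {E F G : Type*} [AddCommGroup E] [Module ℂ E] [AddCommGroup F]
    [Module ℂ F] [AddCommGroup G] [Module ℂ G] {s : Set E} {t : Set F} (f g : E →ₗ[ℂ] F →ₗ[ℂ] G)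
    (h : ∀ x ∈ s, ∀ y ∈ t, f x y = g x y) {x : E} {y : F} (hx : x ∈ Submodule.span ℂ s)
    (hy : y ∈ Submodule.span ℂ t) : f x y = g x y := by
  induction hx using Submodule.span_induction with
  | mem x hx =>
    induction hy using Submodule.span_induction with
    | mem y hy => exact h x hx y hy
    | zero => simp
    | add a b _ _ ha hb => simp [ha, hb]
    | smul c a _ ha => simp [ha]
  | zero => simp
  | add a b _ _ ha hb => simp [ha, hb]
  | smul c a _ ha => simp [ha]

/-- Each common index is counted in both `S` and `S'` but is absent from the symmetric difference,
which accounts for a factor `i ^ 2 = -1`. Locality of `S` puts all common indices in `A`. -/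
theorem I_pow_countIn_symmDiff {S S' : Finset (Fin (N * 2))} (hS : ∀ k ∈ S, k.divNat ∈ A) :
    Complex.I ^ countIn A (symmDiff S S') =
      Complex.I ^ countIn A S * Complex.I ^ countIn A S' * (-1) ^ (S ∩ S').card := by
  have h1 := card_symmDiff_add (S.filter fun k => k.divNat ∈ A) (S'.filter fun k => k.divNat ∈ A)
  have h2 : symmDiff (S.filter fun k => k.divNat ∈ A) (S'.filter fun k => k.divNat ∈ A) =
      (symmDiff S S').filter fun k => k.divNat ∈ A := by
    ext k; simp only [Finset.mem_symmDiff, Finset.mem_filter]; tauto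
  have h3 : (S.filter fun k => k.divNat ∈ A) ∩ (S'.filter fun k => k.divNat ∈ A) = S ∩ S' := by
    ext k; simp only [Finset.mem_inter, Finset.mem_filter]
    exact ⟨fun h => ⟨h.1.1, h.2.1⟩, fun h => ⟨⟨h.1, hS k h.1⟩, h.2, hS k h.1⟩⟩
  rw [h2, h3] at h1
  simp only [countIn]
  rw [← pow_add, ← h1, pow_add, pow_mul, Complex.I_sq, mul_assoc, ← mul_pow]
  simp

/-- The sign `(-1) ^ |S ∩ S'|` from the powers of `i` cancels the sign of exchanging the two
monomials, leaving the product in reversed order. -/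
theorem partialTranspose_mul_left {Y X : Op N} (hY : Y ∈ evenSpan A)
    (hX : X ∈ evenSpan Finset.univ) :
    partialTranspose A (Y * X) = partialTranspose A X * partialTranspose A Y := by
  have h := bilinear_eq_of_span
    ((LinearMap.mul ℂ (Op N)).compr₂ (partialTransposeLinear A))
    ((LinearMap.mul ℂ (Op N)).flip.compl₁₂ (partialTransposeLinear A) (partialTransposeLinear A))
    ?_ hY hX
  · simpa [partialTransposeLinear_apply] using h
  · rintro _ ⟨S, hS, rfl⟩ _ ⟨S', hS', rfl⟩
    simp only [LinearMap.compr₂_apply, LinearMap.compl₁₂_apply, LinearMap.mul_apply',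
      LinearMap.flip_apply, partialTransposeLinear_apply]
    rw [partialTranspose_of_signEq A (signEq_monomial_mul_monomial S S'),
      partialTranspose_monomial, partialTranspose_monomial, I_pow_countIn_symmDiff hS.2,
      monomial_mul_monomial_comm S hS'.1, smul_smul, mul_assoc, ← mul_pow, smul_mul_smul_comm]
    congr 1
    simp [mul_comm]

theorem partialTranspose_mul_right {Y X : Op N} (hY : Y ∈ evenSpan A)
    (hX : X ∈ evenSpan Finset.univ) :
    partialTranspose A (X * Y) = partialTranspose A Y * partialTranspose A X := by
  have h := bilinear_eq_of_span
    ((LinearMap.mul ℂ (Op N)).flip.compr₂ (partialTransposeLinear A))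
    ((LinearMap.mul ℂ (Op N)).compl₁₂ (partialTransposeLinear A) (partialTransposeLinear A))
    ?_ hY hX
  · simpa [partialTransposeLinear_apply] using h
  · rintro _ ⟨S, hS, rfl⟩ _ ⟨S', hS', rfl⟩
    simp only [LinearMap.compr₂_apply, LinearMap.compl₁₂_apply, LinearMap.mul_apply',
      LinearMap.flip_apply, partialTransposeLinear_apply]
    have hT := partialTranspose_of_signEq A (signEq_monomial_mul_monomial S' S)
    rw [symmDiff_comm, I_pow_countIn_symmDiff hS.2, monomial_mul_monomial_comm S' hS.1] at hT
    rw [monomial_mul_monomial_comm S' hS.1, hT,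
      partialTranspose_monomial, partialTranspose_monomial, smul_smul, mul_assoc,
      Finset.inter_comm, ← mul_pow, smul_mul_smul_comm]
    congr 1
    simp

theorem countIn_symmDiff_of_compl {S S' : Finset (Fin (N * 2))} (hS : ∀ k ∈ S, k.divNat ∈ Aᶜ) :
    countIn A (symmDiff S S') = countIn A S' := by
  rw [countIn, countIn]
  congr 1
  ext k
  have : k ∈ S → k.divNat ∉ A := fun h => Finset.mem_compl.1 (hS k h)
  simp only [Finset.mem_symmDiff, Finset.mem_filter]
  tauto

/-- Multiplication by operators outside `A` leaves the number of `A`-indices unchanged. -/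
theorem partialTranspose_mul_left_compl {Z X : Op N} (hZ : Z ∈ evenSpan Aᶜ)
    (hX : X ∈ evenSpan Finset.univ) :
    partialTranspose A (Z * X) = Z * partialTranspose A X := by
  have h := bilinear_eq_of_span
    ((LinearMap.mul ℂ (Op N)).compr₂ (partialTransposeLinear A))
    ((LinearMap.mul ℂ (Op N)).compl₂ (partialTransposeLinear A))
    ?_ hZ hX
  · simpa [partialTransposeLinear_apply] using h
  · rintro _ ⟨S, hS, rfl⟩ _ ⟨S', hS', rfl⟩
    simp only [LinearMap.compr₂_apply, LinearMap.compl₂_apply, LinearMap.mul_apply',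
      partialTransposeLinear_apply]
    rw [partialTranspose_of_signEq A (signEq_monomial_mul_monomial S S'),
      partialTranspose_monomial, countIn_symmDiff_of_compl hS.2, Matrix.mul_smul]

theorem partialTranspose_mul_right_compl {Z X : Op N} (hZ : Z ∈ evenSpan Aᶜ)
    (hX : X ∈ evenSpan Finset.univ) :
    partialTranspose A (X * Z) = partialTranspose A X * Z := by
  have h := bilinear_eq_of_span
    ((LinearMap.mul ℂ (Op N)).flip.compr₂ (partialTransposeLinear A))
    ((LinearMap.mul ℂ (Op N)).flip.compl₂ (partialTransposeLinear A))
    ?_ hZ hX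
  · simpa [partialTransposeLinear_apply] using h
  · rintro _ ⟨S, hS, rfl⟩ _ ⟨S', hS', rfl⟩
    simp only [LinearMap.compr₂_apply, LinearMap.compl₂_apply, LinearMap.mul_apply',
      LinearMap.flip_apply, partialTransposeLinear_apply]
    rw [partialTranspose_of_signEq A (signEq_monomial_mul_monomial S' S),
      partialTranspose_monomial, symmDiff_comm, countIn_symmDiff_of_compl hS.2, Matrix.smul_mul]

/-- An even monomial inside `A` is scaled by an even power of `i`, a real number; for a monomial
with an odd number of factors in `A` the scalar would be imaginary. -/
theorem partialTranspose_conjTranspose {Y : Op N} (hY : Y ∈ evenSpan A) :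
    partialTranspose A Yᴴ = (partialTranspose A Y)ᴴ := by
  induction hY using Submodule.span_induction with
  | mem x hx =>
    obtain ⟨S, hS, rfl⟩ := hx
    rw [partialTranspose_of_signEq A (signEq_monomial_conjTranspose S), partialTranspose_monomial,
      conjTranspose_smul]
    have h : Even (countIn A S) := by
      rw [countIn, Finset.filter_true_of_mem hS.2]; exact hS.1
    obtain ⟨m, hm⟩ := h
    congr 1
    rw [hm, ← two_mul, pow_mul]
    simp
  | zero => simp [partialTranspose_zero]
  | add x y _ _ hx hy => simp only [partialTranspose_add, conjTranspose_add, hx, hy]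
  | smul a x _ hx => simp only [partialTranspose_smul, conjTranspose_smul, hx]

theorem commute_of_mem_evenSpan {Y Z : Op N} (hY : Y ∈ evenSpan A) (hZ : Z ∈ evenSpan Aᶜ) :
    Y * Z = Z * Y := by
  refine bilinear_eq_of_span (LinearMap.mul ℂ (Op N)) (LinearMap.mul ℂ (Op N)).flip ?_ hY hZ
  rintro _ ⟨S, hS, rfl⟩ _ ⟨S', hS', rfl⟩
  simp only [LinearMap.mul_apply', LinearMap.flip_apply]
  have h : S ∩ S' = ∅ := by
    ext k
    simp only [Finset.mem_inter, Finset.notMem_empty, iff_false, not_and]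
    exact fun h1 h2 => Finset.mem_compl.1 (hS'.2 k h2) (hS.2 k h1)
  rw [monomial_mul_monomial_comm S hS'.1, h]
  simp

/-- The trace factorizes on products of operators local to complementary sets of modes. -/
theorem trace_mul_of_mem_evenSpan {Y Z : Op N} (hY : Y ∈ evenSpan A) (hZ : Z ∈ evenSpan Aᶜ) :
    (Y * Z).trace * 2 ^ N = Y.trace * Z.trace := by
  have h := bilinear_eq_of_span
    ((LinearMap.mul ℂ (Op N)).compr₂ ((2 : ℂ) ^ N • traceLinearMap (Occ N) ℂ ℂ))
    ((LinearMap.mul ℂ ℂ).compl₁₂ (traceLinearMap (Occ N) ℂ ℂ) (traceLinearMap (Occ N) ℂ ℂ))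
    ?_ hY hZ
  · simpa [mul_comm] using h
  · rintro _ ⟨S, hS, rfl⟩ _ ⟨S', hS', rfl⟩
    simp only [LinearMap.compr₂_apply, LinearMap.compl₁₂_apply, LinearMap.mul_apply',
      LinearMap.smul_apply, traceLinearMap_apply, smul_eq_mul]
    by_cases h : S = ∅
    · subst h; simp
    · have h1 : symmDiff S S' ≠ ∅ := by
        intro h0
        obtain rfl : S = S' := by simpa using h0
        obtain ⟨k, hk⟩ := Finset.nonempty_iff_ne_empty.2 h
        exact Finset.mem_compl.1 (hS'.2 k hk) (hS.2 k hk)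
      rw [trace_monomial h]
      rcases signEq_monomial_mul_monomial S S' with h2 | h2 <;> simp [h2, trace_monomial h1]

theorem conjTranspose_mem_evenSpan {Y : Op N} (hY : Y ∈ evenSpan A) : Yᴴ ∈ evenSpan A := by
  induction hY using Submodule.span_induction with
  | mem x hx =>
    obtain ⟨S, hS, rfl⟩ := hx
    exact ((signEq_monomial_conjTranspose S).mem_iff _).2 (monomial_mem_evenSpan hS.1 hS.2)
  | zero => simp
  | add x y _ _ hx hy => rw [conjTranspose_add]; exact Submodule.add_mem _ hx hy
  | smul a x _ hx => rw [conjTranspose_smul]; exact Submodule.smul_mem _ _ hx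

/-- The trace of `YᴴY ZZᴴ` vanishes and is proportional to `Tr (YᴴY) Tr (ZZᴴ)`, so one of these
squared Hilbert–Schmidt norms is zero. -/
theorem eq_zero_or_eq_zero_of_mul_eq_zero {Y Z : Op N} (hY : Y ∈ evenSpan A)
    (hZ : Z ∈ evenSpan Aᶜ) (h : Y * Z = 0) : Y = 0 ∨ Z = 0 := by
  have h1 := trace_mul_of_mem_evenSpan (mul_mem_evenSpan (conjTranspose_mem_evenSpan hY) hY)
    (mul_mem_evenSpan hZ (conjTranspose_mem_evenSpan hZ))
  have h2 : Yᴴ * Y * (Z * Zᴴ) = Yᴴ * (Y * Z) * Zᴴ := by simp only [Matrix.mul_assoc]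
  rw [h2, h] at h1
  simp only [mul_zero, trace_zero, zero_mul] at h1
  rcases mul_eq_zero.1 h1.symm with h3 | h3
  · exact Or.inl (trace_conjTranspose_mul_self_eq_zero_iff.1 h3)
  · exact Or.inr (trace_mul_conjTranspose_self_eq_zero_iff.1 h3)

theorem isStarProjection_partialTranspose {Y : Op N} (hY : Y ∈ evenSpan A)
    (h : IsStarProjection Y) : IsStarProjection (partialTranspose A Y) := by
  constructor
  · change _ * _ = _
    rw [← partialTranspose_mul_left hY (evenSpan_mono (Finset.subset_univ _) hY),
      h.isIdempotentElem]
  · change _ᴴ = _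
    rw [← partialTranspose_conjTranspose hY]
    exact congrArg _ h.isSelfAdjoint

end PartialTranspose

/-! ### Tensor products with an ancilla -/

section Tensor

variable {M N : ℕ}

theorem tensor_eq_reindex (Y : Op M) (X : Op N) :
    tensor Y X = (kroneckerMap (· * ·) Y X).submatrix (Fin.appendEquiv M N).symm
      (Fin.appendEquiv M N).symm := rfl

theorem tensor_mul_tensor (Y Y' : Op M) (X X' : Op N) :
    tensor Y X * tensor Y' X' = tensor (Y * Y') (X * X') := by
  simp only [tensor_eq_reindex]
  rw [submatrix_mul_equiv, ← mul_kronecker_mul]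

theorem tensor_one_one : tensor (1 : Op M) (1 : Op N) = 1 := by
  rw [tensor_eq_reindex, one_kronecker_one, submatrix_one_equiv]

theorem tensor_conjTranspose (Y : Op M) (X : Op N) : (tensor Y X)ᴴ = tensor Yᴴ Xᴴ := by
  simp only [tensor_eq_reindex, conjTranspose_submatrix, conjTranspose_kronecker]

theorem trace_tensor (Y : Op M) (X : Op N) : (tensor Y X).trace = Y.trace * X.trace := by
  rw [tensor_eq_reindex, ← trace_kronecker]
  exact Fintype.sum_equiv (Fin.appendEquiv M N).symm _ _ fun _ => rfl

theorem posSemidef_tensor {Y : Op M} {X : Op N} (hY : Y.PosSemidef) (hX : X.PosSemidef) :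
    (tensor Y X).PosSemidef :=
  (hY.kronecker hX).submatrix (Fin.appendEquiv M N).symm

/-- The tensor product as a bilinear map. -/
def tensorLinear : Op M →ₗ[ℂ] Op N →ₗ[ℂ] Op (M + N) :=
  LinearMap.mk₂ ℂ tensor (fun _ _ _ => by ext; simp [tensor, add_mul])
    (fun _ _ _ => by ext; simp [tensor, mul_assoc]) (fun _ _ _ => by ext; simp [tensor, mul_add])
    (fun _ _ _ => by ext; simp [tensor, mul_left_comm])

@[simp] theorem tensorLinear_apply (Y : Op M) (X : Op N) : tensorLinear Y X = tensor Y X := rfl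

theorem tensor_smul_smul (a b : ℂ) (Y : Op M) (X : Op N) :
    tensor (a • Y) (b • X) = (a * b) • tensor Y X := by
  simp only [← tensorLinear_apply, map_smul, LinearMap.smul_apply, smul_smul, mul_comm]

/-- Since `Y` is positive, `Y ⊗ √(X Xᴴ)` is the positive square root of `(Y ⊗ X)(Y ⊗ X)ᴴ`. -/
theorem traceNorm_tensor {Y : Op M} (hY : Y.PosSemidef) (X : Op N) :
    traceNorm (tensor Y X) = Y.trace.re * traceNorm X := by
  have hX : (CFC.sqrt (X * Xᴴ)).PosSemidef := nonneg_iff_posSemidef.1 (CFC.sqrt_nonneg _)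
  have h : CFC.sqrt (tensor Y X * (tensor Y X)ᴴ) = tensor Y (CFC.sqrt (X * Xᴴ)) := by
    apply CFC.sqrt_unique
    · rw [tensor_mul_tensor, tensor_conjTranspose, tensor_mul_tensor,
        CFC.sqrt_mul_sqrt_self _ (posSemidef_self_mul_conjTranspose X).nonneg, hY.isHermitian.eq]
    · exact (posSemidef_tensor hY hX).nonneg
  have h2 := (Complex.le_def.1 hY.trace_nonneg).2
  rw [traceNorm, h, trace_tensor, Complex.mul_re, ← h2, traceNorm]
  simp

/-- The Majorana operators of the ancilla. -/
def ancillaIndex (k : Fin (M * 2)) : Fin ((M + N) * 2) := ⟨k, by omega⟩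

/-- The Majorana operators of the system. -/
def systemIndex (l : Fin (N * 2)) : Fin ((M + N) * 2) := ⟨M * 2 + l, by omega⟩

theorem divNat_ancillaIndex (k : Fin (M * 2)) :
    (ancillaIndex k : Fin ((M + N) * 2)).divNat = Fin.castAdd N k.divNat := by
  ext; simp [ancillaIndex]

theorem modNat_ancillaIndex (k : Fin (M * 2)) :
    (ancillaIndex k : Fin ((M + N) * 2)).modNat = k.modNat := by
  ext; simp [ancillaIndex]

theorem divNat_systemIndex (l : Fin (N * 2)) :
    (systemIndex l : Fin ((M + N) * 2)).divNat = Fin.natAdd M l.divNat := by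
  ext; simp [systemIndex]; omega

theorem modNat_systemIndex (l : Fin (N * 2)) :
    (systemIndex l : Fin ((M + N) * 2)).modNat = l.modNat := by
  ext; simp [systemIndex]

theorem signChar_map_union (T : Finset (Fin M)) (T' : Finset (Fin N)) (n : Occ (M + N)) :
    signChar (T.map (Fin.castAddEmb N) ∪ T'.map (Fin.natAddEmb M)) n =
      signChar T (fun i => n (Fin.castAdd N i)) * signChar T' (fun j => n (Fin.natAdd M j)) := by
  rw [signChar, Finset.prod_union, Finset.prod_map, Finset.prod_map]
  · rfl
  · rw [Finset.disjoint_left]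
    intro x hx hx'
    obtain ⟨i, -, rfl⟩ := Finset.mem_map.1 hx
    obtain ⟨j, -, hj⟩ := Finset.mem_map.1 hx'
    have := congrArg Fin.val hj
    simp at this
    omega

theorem tensor_pauli_pauli (e : Occ M) (T : Finset (Fin M)) (e' : Occ N) (T' : Finset (Fin N)) :
    tensor (pauli e T) (pauli e' T') = pauli (Fin.append e e')
      (T.map (Fin.castAddEmb N) ∪ T'.map (Fin.natAddEmb M)) := by
  ext n' n
  have h : n' = n + Fin.append e e' ↔
      (fun i => n' (Fin.castAdd N i)) = (fun i => n (Fin.castAdd N i)) + e ∧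
        (fun j => n' (Fin.natAdd M j)) = (fun j => n (Fin.natAdd M j)) + e' := by
    constructor
    · rintro rfl
      constructor <;> ext i <;> simp
    · rintro ⟨h1, h2⟩
      ext i
      refine Fin.addCases (fun i => ?_) (fun j => ?_) i
      · simpa using congrArg Fin.val (congrFun h1 i)
      · simpa using congrArg Fin.val (congrFun h2 j)
  simp only [tensor, pauli, of_apply, signChar_map_union]
  rw [if_congr h rfl rfl]
  split_ifs with h1 h2 h3 h3 <;> simp_all

theorem pauli_zero_empty : pauli 0 ∅ = (1 : Op N) := by
  ext n' n
  simp [pauli, signChar, one_apply]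

theorem append_single_zero (i : Fin M) :
    Fin.append (Pi.single i 1 : Occ M) (0 : Occ N) = Pi.single (Fin.castAdd N i) 1 := by
  ext x
  refine Fin.addCases (fun k => ?_) (fun k => ?_) x
  · simp [Pi.single_apply]
  · have : Fin.natAdd M k ≠ Fin.castAdd N i := by
      intro h; have := congrArg Fin.val h; simp at this; omega
    simp [this]

theorem append_zero_single (j : Fin N) :
    Fin.append (0 : Occ M) (Pi.single j 1 : Occ N) = Pi.single (Fin.natAdd M j) 1 := by
  ext x
  refine Fin.addCases (fun k => ?_) (fun k => ?_) x
  · have : Fin.castAdd N k ≠ Fin.natAdd M j := by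
      intro h; have := congrArg Fin.val h; simp at this; omega
    simp [this]
  · simp [Pi.single_apply]

theorem signSites_ancillaIndex (k : Fin (M * 2)) :
    signSites (ancillaIndex k : Fin ((M + N) * 2)) =
      (signSites k).map (Fin.castAddEmb N) ∪ (∅ : Finset (Fin N)).map (Fin.natAddEmb M) := by
  ext x
  simp only [signSites, divNat_ancillaIndex, modNat_ancillaIndex, Finset.mem_filter,
    Finset.mem_univ, true_and, Finset.map_empty, Finset.union_empty, Finset.mem_map]
  refine Fin.addCases (fun i => ?_) (fun j => ?_) x
  · constructor
    · intro h
      exact ⟨i, by simpa [Fin.ext_iff, Fin.lt_def] using h, rfl⟩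
    · rintro ⟨a, ha, hai⟩
      obtain rfl : a = i := Fin.castAdd_injective M N hai
      simpa [Fin.ext_iff, Fin.lt_def] using ha
  · simp only [Fin.ext_iff, Fin.lt_def, Fin.castAddEmb_apply, Fin.val_natAdd, Fin.val_castAdd]
    constructor
    · intro h; omega
    · rintro ⟨a, -, ha⟩; omega

theorem signSites_systemIndex (l : Fin (N * 2)) :
    signSites (systemIndex l : Fin ((M + N) * 2)) =
      (Finset.univ : Finset (Fin M)).map (Fin.castAddEmb N) ∪
        (signSites l).map (Fin.natAddEmb M) := by
  ext x
  simp only [signSites, divNat_systemIndex, modNat_systemIndex, Finset.mem_filter,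
    Finset.mem_univ, true_and, Finset.mem_union, Finset.mem_map]
  refine Fin.addCases (fun i => ?_) (fun j => ?_) x
  · refine iff_of_true (Or.inl ?_) (Or.inl ⟨i, rfl⟩)
    simp only [Fin.lt_def, Fin.val_natAdd, Fin.val_castAdd]; omega
  · have : ¬∃ a : Fin M, (Fin.castAddEmb N) a = Fin.natAdd M j := by
      rintro ⟨a, ha⟩; have := congrArg Fin.val ha; simp at this; omega
    simp only [this, false_or]
    constructor
    · intro h
      exact ⟨j, by simpa [Fin.ext_iff, Fin.lt_def] using h, rfl⟩
    · rintro ⟨a, ha, haj⟩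
      obtain rfl : a = j := Fin.natAdd_injective N M haj
      simpa [Fin.ext_iff, Fin.lt_def] using ha

theorem tensor_majorana_one (k : Fin (M * 2)) :
    tensor (majorana k) (1 : Op N) = majorana (ancillaIndex k) := by
  rw [majorana_eq_pauli, majorana_eq_pauli, modNat_ancillaIndex, divNat_ancillaIndex,
    signSites_ancillaIndex, ← append_single_zero, ← tensor_pauli_pauli, pauli_zero_empty]
  conv_lhs => rw [← one_smul ℂ (1 : Op N), tensor_smul_smul, mul_one]

/-- The ancilla modes are numbered first, so the Jordan–Wigner string of a system operator runs over
all of them and forms the ancilla parity. -/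
theorem tensor_parity_majorana (l : Fin (N * 2)) :
    tensor (parity M) (majorana l) = majorana (systemIndex l) := by
  rw [majorana_eq_pauli, majorana_eq_pauli, modNat_systemIndex, divNat_systemIndex,
    signSites_systemIndex, ← append_zero_single, ← tensor_pauli_pauli, ← parity_eq_pauli]
  conv_lhs => rw [← one_smul ℂ (parity M), tensor_smul_smul, one_mul]

theorem tensor_parity_parity : tensor (parity M) (parity N) = parity (M + N) := by
  have h : (Finset.univ : Finset (Fin (M + N))) =
      Finset.univ.map (Fin.castAddEmb N) ∪ Finset.univ.map (Fin.natAddEmb M) := by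
    ext x
    refine Fin.addCases (fun i => ?_) (fun j => ?_) x <;> simp
  have h0 : Fin.append (0 : Occ M) (0 : Occ N) = 0 := by
    ext x
    refine Fin.addCases (fun i => ?_) (fun j => ?_) x <;> simp
  rw [parity_eq_pauli, parity_eq_pauli, parity_eq_pauli, tensor_pauli_pauli, ← h, h0]

theorem tensor_majoranaProd_one (l : List (Fin (M * 2))) :
    tensor (majoranaProd l) (1 : Op N) = majoranaProd (l.map ancillaIndex) := by
  induction l with
  | nil => simpa using tensor_one_one
  | cons k l ih =>
    rw [List.map_cons, majoranaProd_cons, majoranaProd_cons, ← ih, ← tensor_majorana_one,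
      tensor_mul_tensor, mul_one]

theorem tensor_parity_pow_majoranaProd (l : List (Fin (N * 2))) :
    tensor (parity M ^ l.length) (majoranaProd l) = majoranaProd (l.map systemIndex) := by
  induction l with
  | nil => simpa using tensor_one_one
  | cons k l ih =>
    rw [List.map_cons, majoranaProd_cons, majoranaProd_cons, ← ih, ← tensor_parity_majorana,
      tensor_mul_tensor, List.length_cons, pow_succ']

/-- An even number of system operators brings an even power of the ancilla parity, which is `1`; so
the ungraded tensor product of the monomials is a Majorana product. -/
theorem tensor_majoranaProd (l : List (Fin (M * 2))) {l' : List (Fin (N * 2))}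
    (hl' : Even l'.length) :
    tensor (majoranaProd l) (majoranaProd l') =
      majoranaProd (l.map ancillaIndex ++ l'.map systemIndex) := by
  obtain ⟨m, hm⟩ := hl'
  rw [majoranaProd_append, ← tensor_majoranaProd_one, ← tensor_parity_pow_majoranaProd,
    tensor_mul_tensor, one_mul, hm, ← two_mul, pow_mul, pow_two, parity_mul_self, one_pow, mul_one]

theorem ancillaIndex_injective :
    Function.Injective (ancillaIndex : Fin (M * 2) → Fin ((M + N) * 2)) := by
  intro a b h
  have := congrArg Fin.val h
  exact Fin.ext this

theorem systemIndex_injective :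
    Function.Injective (systemIndex : Fin (N * 2) → Fin ((M + N) * 2)) := by
  intro a b h
  have := congrArg Fin.val h
  exact Fin.ext (by simpa [systemIndex] using this)

theorem ancillaIndex_ne_systemIndex (k : Fin (M * 2)) (l : Fin (N * 2)) :
    (ancillaIndex k : Fin ((M + N) * 2)) ≠ systemIndex l := by
  intro h
  have := congrArg Fin.val h
  simp only [ancillaIndex, systemIndex] at this
  omega

/-- The Majorana operators of a tensor product of monomials. -/
def joinIndex (S : Finset (Fin (M * 2))) (S' : Finset (Fin (N * 2))) : Finset (Fin ((M + N) * 2)) :=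
  S.image ancillaIndex ∪ S'.image systemIndex

theorem signEq_tensor_monomial (S : Finset (Fin (M * 2))) {S' : Finset (Fin (N * 2))}
    (hS' : Even S'.card) :
    SignEq (tensor (monomial S) (monomial S')) (monomial (joinIndex S S')) := by
  rw [monomial_eq_majoranaProd, monomial_eq_majoranaProd S', tensor_majoranaProd]
  · have h : (((S.sort (· ≤ ·)).map ancillaIndex ++ (S'.sort (· ≤ ·)).map systemIndex :
        List (Fin ((M + N) * 2)))).Nodup := by
      refine List.Nodup.append ((Finset.sort_nodup _ _).map ancillaIndex_injective)
        ((Finset.sort_nodup _ _).map systemIndex_injective) ?_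
      intro x hx hx'
      obtain ⟨k, -, rfl⟩ := List.mem_map.1 hx
      obtain ⟨l, -, hl⟩ := List.mem_map.1 hx'
      exact ancillaIndex_ne_systemIndex k l hl.symm
    convert signEq_majoranaProd h using 2
    ext x; simp [joinIndex]
  · rwa [Finset.length_sort]

theorem disjoint_joinIndex (S : Finset (Fin (M * 2))) (S' : Finset (Fin (N * 2))) :
    Disjoint (S.image (ancillaIndex : _ → Fin ((M + N) * 2))) (S'.image systemIndex) := by
  rw [Finset.disjoint_left]
  intro x hx hx'
  obtain ⟨k, -, rfl⟩ := Finset.mem_image.1 hx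
  obtain ⟨l, -, hl⟩ := Finset.mem_image.1 hx'
  exact ancillaIndex_ne_systemIndex k l hl.symm

theorem card_joinIndex (S : Finset (Fin (M * 2))) (S' : Finset (Fin (N * 2))) :
    (joinIndex S S').card = S.card + S'.card := by
  rw [joinIndex, Finset.card_union_of_disjoint (disjoint_joinIndex S S'),
    Finset.card_image_of_injective _ ancillaIndex_injective,
    Finset.card_image_of_injective _ systemIndex_injective]

theorem castAdd_mem_withAncilla (A : Finset (Fin N)) (i : Fin M) :
    Fin.castAdd N i ∈ withAncilla M A := by simp [withAncilla]

theorem natAdd_mem_withAncilla (A : Finset (Fin N)) (j : Fin N) :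
    Fin.natAdd M j ∈ withAncilla M A ↔ j ∈ A := by
  have h : ∀ i : Fin M, Fin.castAdd N i ≠ Fin.natAdd M j := by
    intro i h
    have := congrArg Fin.val h
    simp at this
    omega
  simp [withAncilla, h]

theorem countIn_joinIndex (A : Finset (Fin N)) (S : Finset (Fin (M * 2)))
    (S' : Finset (Fin (N * 2))) :
    countIn (withAncilla M A) (joinIndex S S') = countIn Finset.univ S + countIn A S' := by
  have h : (joinIndex S S').filter (fun k => k.divNat ∈ withAncilla M A) =
      joinIndex S (S'.filter fun k => k.divNat ∈ A) := by
    ext x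
    simp only [joinIndex, Finset.mem_filter, Finset.mem_union, Finset.mem_image]
    constructor
    · rintro ⟨⟨k, hk, rfl⟩ | ⟨l, hl, rfl⟩, hx⟩
      · exact Or.inl ⟨k, hk, rfl⟩
      · rw [divNat_systemIndex, natAdd_mem_withAncilla] at hx
        exact Or.inr ⟨l, ⟨hl, hx⟩, rfl⟩
    · rintro (⟨k, hk, rfl⟩ | ⟨l, hl, rfl⟩)
      · exact ⟨Or.inl ⟨k, hk, rfl⟩, by rw [divNat_ancillaIndex]; exact castAdd_mem_withAncilla A _⟩
      · exact ⟨Or.inr ⟨l, hl.1, rfl⟩, by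
          rw [divNat_systemIndex, natAdd_mem_withAncilla]; exact hl.2⟩
  rw [countIn, h, card_joinIndex, countIn, countIn]
  simp

/-- The partial transpose of a tensor product of physical operators. -/
theorem partialTranspose_tensor (A : Finset (Fin N)) {Y : Op M} {X : Op N}
    (hY : Y ∈ evenSpan Finset.univ) (hX : X ∈ evenSpan Finset.univ) :
    partialTranspose (withAncilla M A) (tensor Y X) =
      tensor (partialTranspose Finset.univ Y) (partialTranspose A X) := by
  have h := bilinear_eq_of_span
    (tensorLinear.compr₂ (partialTransposeLinear (withAncilla M A)))
    (tensorLinear.compl₁₂ (partialTransposeLinear Finset.univ) (partialTransposeLinear A))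
    ?_ hY hX
  · simpa [partialTransposeLinear_apply] using h
  · rintro _ ⟨S, hS, rfl⟩ _ ⟨S', hS', rfl⟩
    simp only [LinearMap.compr₂_apply, LinearMap.compl₁₂_apply, tensorLinear_apply,
      partialTransposeLinear_apply]
    rw [partialTranspose_of_signEq _ (signEq_tensor_monomial S hS'.1), partialTranspose_monomial,
      partialTranspose_monomial, tensor_smul_smul, countIn_joinIndex, pow_add]

theorem tensor_mem_evenSpan {Y : Op M} {X : Op N} (hY : Y ∈ evenSpan Finset.univ)
    (hX : X ∈ evenSpan Finset.univ) : tensor Y X ∈ evenSpan Finset.univ := by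
  have h := Submodule.apply_mem_map₂ tensorLinear hY hX
  rw [evenSpan, evenSpan, Submodule.map₂_span_span] at h
  refine Submodule.span_le.2 ?_ h
  rintro _ ⟨_, ⟨S, hS, rfl⟩, _, ⟨S', hS', rfl⟩, rfl⟩
  exact ((signEq_tensor_monomial S hS'.1).mem_iff _).2
    (monomial_mem_evenSpan (by rw [card_joinIndex]; exact hS.1.add hS'.1) (by simp))

theorem tensor_one_mem_evenSpan (A : Finset (Fin N)) {Y : Op M} (hY : Y ∈ evenSpan Finset.univ) :
    tensor Y 1 ∈ evenSpan (withAncilla M A) := by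
  have h : evenSpan Finset.univ ≤
      (evenSpan (withAncilla M A)).comap (tensorLinear.flip (1 : Op N)) := by
    refine Submodule.span_le.2 ?_
    rintro _ ⟨S, hS, rfl⟩
    have h1 := signEq_tensor_monomial S (S' := (∅ : Finset (Fin (N * 2)))) (by simp)
    rw [monomial_empty] at h1
    refine (h1.mem_iff _).2 (monomial_mem_evenSpan (by simpa [card_joinIndex] using hS.1) ?_)
    intro x hx
    simp only [joinIndex, Finset.image_empty, Finset.union_empty, Finset.mem_image] at hx
    obtain ⟨k, -, rfl⟩ := hx
    rw [divNat_ancillaIndex]; exact castAdd_mem_withAncilla A _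
  exact h hY

/-- The transpose of a density matrix is positive semidefinite. -/
theorem IsDensity.posSemidef_partialTranspose_univ {ρ : Op M} (hρ : IsDensity ρ) :
    (partialTranspose Finset.univ ρ).PosSemidef := by
  have hB : CFC.sqrt ρ * CFC.sqrt ρ = ρ := CFC.sqrt_mul_sqrt_self _ hρ.posSemidef.nonneg
  have hH : (CFC.sqrt ρ)ᴴ = CFC.sqrt ρ :=
    (nonneg_iff_posSemidef.1 (CFC.sqrt_nonneg ρ)).isHermitian
  have hphys : IsPhysical (CFC.sqrt ρ) := by
    have hPH : (parity M)ᴴ = parity M := by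
      rw [parity, diagonal_conjTranspose]; congr; ext; simp
    -- Conjugating the root by the parity gives another positive root of `ρ`; uniqueness makes the
    -- root physical, hence even.
    refine Eq.symm (CFC.sqrt_unique ?_ ?_)
    · calc _ = parity M * CFC.sqrt ρ * (parity M * parity M) * CFC.sqrt ρ * parity M := by
            simp only [Matrix.mul_assoc]
        _ = parity M * ρ * parity M := by
            rw [parity_mul_self, mul_one, Matrix.mul_assoc (parity M), hB]
        _ = ρ := hρ.physical
    · have := (nonneg_iff_posSemidef.1 (CFC.sqrt_nonneg ρ)).mul_mul_conjTranspose_same (parity M)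
      rw [hPH] at this
      exact this.nonneg
  -- With `B = √ρ`, reversal of products and compatibility with adjoints give `ρᵀ = (Bᵀ)ᴴ Bᵀ`.
  rw [← hB, partialTranspose_mul_left hphys.mem_evenSpan hphys.mem_evenSpan]
  nth_rw 1 [← hH]
  rw [partialTranspose_conjTranspose hphys.mem_evenSpan]
  exact posSemidef_conjTranspose_mul_self _

/-- `X` is any even operator rather than a state, so that the lemma can also strip `|μ⟩⟨μ|` from
unnormalized measurement outcomes. -/
theorem IsDensity.traceNorm_partialTranspose_tensor (A : Finset (Fin N)) {ρR : Op M}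
    (hρR : IsDensity ρR) {X : Op N} (hX : X ∈ evenSpan Finset.univ) :
    traceNorm (partialTranspose (withAncilla M A) (tensor ρR X)) =
      traceNorm (partialTranspose A X) := by
  rw [partialTranspose_tensor A hρR.physical.mem_evenSpan hX,
    traceNorm_tensor hρR.posSemidef_partialTranspose_univ, trace_partialTranspose,
    hρR.trace_eq_one]
  simp

end Tensor

/-! ### Measurement outcomes and monotonicity -/

section Measurements

variable {M N : ℕ}

/-- The isometry `|n⟩ ↦ |v⟩ ⊗ |n⟩`. -/
def ancillaKet (N : ℕ) (v : Fock M) : Matrix (Occ (M + N)) (Occ N) ℂ :=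
  Matrix.of fun m n => if (fun j => m (Fin.natAdd M j)) = n then
    v (fun i => m (Fin.castAdd N i)) else 0

theorem sum_occ_add {E : Type*} [AddCommMonoid E] (f : Occ (M + N) → E) :
    ∑ m, f m = ∑ s : Occ M, ∑ n : Occ N, f (Fin.append s n) := by
  rw [← (Fin.appendEquiv M N).sum_comp, Fintype.sum_prod_type]
  rfl

theorem ancillaKet_append (v : Fock M) (s : Occ M) (n n' : Occ N) :
    ancillaKet N v (Fin.append s n) n' = if n = n' then v s else 0 := by
  simp [ancillaKet]

theorem ancillaSandwich_eq (v : Fock M) (X : Op (M + N)) :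
    ancillaSandwich v X = (ancillaKet N v)ᴴ * X * ancillaKet N v := by
  ext n n'
  simp only [ancillaSandwich, of_apply, mul_apply, conjTranspose_apply, sum_occ_add,
    ancillaKet_append, Finset.sum_mul]
  rw [Finset.sum_comm]
  simp [apply_ite, ite_mul]

/-- The rank one operator `|v⟩⟨v|`. -/
def rankOne (v : Fock M) : Op M := vecMulVec v.ofLp (star v.ofLp)

theorem tensor_rankOne (v : Fock M) (X : Op N) :
    tensor (rankOne v) X = ancillaKet N v * X * (ancillaKet N v)ᴴ := by
  ext m m'
  simp [tensor, rankOne, vecMulVec_apply, mul_apply, ancillaKet, apply_ite]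
  ring

theorem sum_star_mul_self {v : Fock M} (hv : ‖v‖ = 1) : ∑ s, star (v s) * v s = 1 := by
  have h := EuclideanSpace.inner_eq_star_dotProduct v v
  rw [inner_self_eq_norm_sq_to_K, hv] at h
  simp only [dotProduct, Pi.star_apply] at h
  simpa [mul_comm] using h.symm

theorem ancillaKet_conjTranspose_mul_self {v : Fock M} (hv : ‖v‖ = 1) :
    (ancillaKet N v)ᴴ * ancillaKet N v = 1 := by
  ext n n'
  simp only [mul_apply, conjTranspose_apply, sum_occ_add, ancillaKet_append]
  have := sum_star_mul_self hv
  by_cases h : n = n'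
  · subst h
    simpa [apply_ite] using this
  · simp [apply_ite, h, Ne.symm h]

/-- After the projection the ancilla factors out as a pure state, which is what lets the appending
lemma compare the block with the system outcome. -/
theorem rankOne_tensor_mul_mul (v : Fock M) (X : Op (M + N)) :
    tensor (rankOne v) 1 * X * tensor (rankOne v) 1 =
      tensor (rankOne v) (ancillaSandwich v X) := by
  simp only [tensor_rankOne, ancillaSandwich_eq, Matrix.mul_one, Matrix.mul_assoc]

theorem parity_conjTranspose : (parity M)ᴴ = parity M := by
  rw [parity, diagonal_conjTranspose]; congr; ext; simp

theorem isDensity_rankOne {v : Fock M} (hv : ‖v‖ = 1) (h : HasDefiniteParity v) :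
    IsDensity (rankOne v) where
  posSemidef := posSemidef_vecMulVec_self_star _
  trace_eq_one := by
    rw [rankOne, trace_vecMulVec, dotProduct]
    simpa [mul_comm] using sum_star_mul_self hv
  physical := by
    rw [IsPhysical, rankOne, mul_vecMulVec, vecMulVec_mul]
    have h1 : star v.ofLp ᵥ* parity M = star (parity M *ᵥ v.ofLp) := by
      rw [star_mulVec, parity_conjTranspose]
    rw [h1]
    rcases h with h | h
    · rw [h]
    · rw [h]; ext; simp [vecMulVec_apply]

theorem isStarProjection_rankOne_tensor {v : Fock M} (hv : ‖v‖ = 1) :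
    IsStarProjection (tensor (rankOne v) (1 : Op N)) := by
  rw [tensor_rankOne, Matrix.mul_one]
  constructor
  · change _ * _ = _
    rw [Matrix.mul_assoc, ← Matrix.mul_assoc _ (ancillaKet N v),
      ancillaKet_conjTranspose_mul_self hv, Matrix.one_mul]
  · change _ᴴ = _
    rw [conjTranspose_mul, conjTranspose_conjTranspose]

theorem rankOne_mul_rankOne {v w : Fock M} (h : inner ℂ v w = 0) :
    rankOne v * rankOne w = 0 := by
  rw [EuclideanSpace.inner_eq_star_dotProduct, dotProduct_comm] at h
  rw [rankOne, rankOne, vecMulVec_mul_vecMulVec, h]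
  ext; simp [vecMulVec_apply]

theorem ancillaSandwich_tensor_rankOne {v : Fock M} (hv : ‖v‖ = 1) (X : Op N) :
    ancillaSandwich v (tensor (rankOne v) X) = X := by
  have h := ancillaKet_conjTranspose_mul_self (N := N) hv
  rw [ancillaSandwich_eq, tensor_rankOne]
  simp only [← Matrix.mul_assoc]
  rw [h, Matrix.one_mul, Matrix.mul_assoc, h, Matrix.mul_one]

/-- `|v⟩⟨v| ⊗ σ` is a product of even operators, hence physical. The parity factorizes and fixes
`|v⟩⟨v|`, and sandwiching with `v` recovers the statement for `σ`. -/
theorem isPhysical_ancillaSandwich {v : Fock M} (hv : ‖v‖ = 1) (h : HasDefiniteParity v)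
    {X : Op (M + N)} (hX : X ∈ evenSpan Finset.univ) : IsPhysical (ancillaSandwich v X) := by
  have hv' := (isDensity_rankOne hv h).physical
  have h1 : tensor (rankOne v) 1 ∈ evenSpan (Finset.univ : Finset (Fin (M + N))) :=
    evenSpan_mono (Finset.subset_univ _) (tensor_one_mem_evenSpan ∅ hv'.mem_evenSpan)
  have h2 : IsPhysical (tensor (rankOne v) (ancillaSandwich v X)) := by
    rw [← rankOne_tensor_mul_mul]
    exact isPhysical_of_mem_evenSpan (mul_mem_evenSpan (mul_mem_evenSpan h1 hX) h1)
  rw [IsPhysical, ← tensor_parity_parity, tensor_mul_tensor, tensor_mul_tensor, hv'] at h2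
  have h3 := congrArg (ancillaSandwich v) h2
  rwa [ancillaSandwich_tensor_rankOne hv, ancillaSandwich_tensor_rankOne hv] at h3

theorem posSemidef_ancillaSandwich (v : Fock M) {X : Op (M + N)} (hX : X.PosSemidef) :
    (ancillaSandwich v X).PosSemidef := by
  rw [ancillaSandwich_eq]
  exact hX.conjTranspose_mul_mul_same _

theorem sum_ancillaSandwich {ι : Type*} [Fintype ι] (b : OrthonormalBasis ι ℂ (Fock M))
    (X : Op (M + N)) : ∑ μ, ancillaSandwich (b μ) X = traceAncilla X := by
  have key : ∀ s s' : Occ M, ∑ μ, star (b μ s) * b μ s' = if s = s' then 1 else 0 := by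
    intro s s'
    have h := b.sum_inner_mul_inner (EuclideanSpace.single s' 1) (EuclideanSpace.single s 1)
    simpa [EuclideanSpace.inner_single_left, EuclideanSpace.inner_single_right, mul_comm,
      PiLp.single_apply] using h
  ext n n'
  simp only [Matrix.sum_apply, ancillaSandwich, traceAncilla, of_apply]
  rw [Finset.sum_comm]
  refine Finset.sum_congr rfl fun s _ => ?_
  rw [Finset.sum_comm]
  have : ∀ s', ∑ μ, star (b μ s) * X (Fin.append s n) (Fin.append s' n') * b μ s' =
      X (Fin.append s n) (Fin.append s' n') * if s = s' then 1 else 0 := by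
    intro s'
    rw [← key, Finset.mul_sum]
    exact Finset.sum_congr rfl fun μ _ => by ring
  simp only [this, mul_ite, mul_one, mul_zero, Finset.sum_ite_eq, Finset.mem_univ, if_true]

theorem trace_traceAncilla (X : Op (M + N)) : (traceAncilla X).trace = X.trace := by
  simp only [trace, traceAncilla, diag_apply, of_apply, sum_occ_add]
  exact Finset.sum_comm

/-- A positive operator of trace zero vanishes, so the convention `0⁻¹ = 0` is harmless for outcomes
of probability zero. -/
theorem smul_smul_inv_eq {X : Op N} (hX : X.PosSemidef) :
    (X.trace.re : ℂ) • ((X.trace.re : ℂ)⁻¹ • X) = X := by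
  by_cases h : X.trace.re = 0
  · have h1 : X.trace = 0 := Complex.ext h (Complex.le_def.1 hX.trace_nonneg).2.symm
    rw [hX.trace_eq_zero_iff.1 h1]; simp
  · rw [smul_smul, mul_inv_cancel₀ (by exact_mod_cast h), one_smul]

theorem re_trace_nonneg_of_posSemidef {X : Op N} (hX : X.PosSemidef) : 0 ≤ X.trace.re :=
  (Complex.le_def.1 hX.trace_nonneg).1

theorem trace_mul_traceNorm_normalized (A : Finset (Fin N)) {X : Op N} (hX : X.PosSemidef) :
    X.trace.re * traceNorm (partialTranspose A ((X.trace.re : ℂ)⁻¹ • X)) =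
      traceNorm (partialTranspose A X) := by
  conv_rhs => rw [← smul_smul_inv_eq hX]
  rw [partialTranspose_smul _ (X.trace.re : ℂ), traceNorm_smul (re_trace_nonneg_of_posSemidef hX)]

theorem traceNorm_normalized_pos (A : Finset (Fin N)) {X : Op N} (h : X.trace.re ≠ 0) :
    0 < traceNorm (partialTranspose A ((X.trace.re : ℂ)⁻¹ • X)) := by
  refine lt_of_lt_of_le one_pos (le_trans (le_of_eq ?_) (re_trace_le_traceNorm _))
  rw [trace_partialTranspose, trace_smul, smul_eq_mul, ← Complex.ofReal_inv, Complex.re_ofReal_mul,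
    inv_mul_cancel₀ h]

theorem IsDensity.one_le_traceNorm {ρ : Op N} (hρ : IsDensity ρ) (A : Finset (Fin N)) :
    1 ≤ traceNorm (partialTranspose A ρ) := by
  refine le_trans (le_of_eq ?_) (re_trace_le_traceNorm _)
  rw [trace_partialTranspose, hρ.trace_eq_one, Complex.one_re]

/-- Monotonicity on average for unnormalized outcomes `X μ` of a measurement. -/
theorem sum_negativity_normalized_le {ι : Type*} [Fintype ι] {A : Finset (Fin N)} {X : ι → Op N}
    (hX : ∀ μ, (X μ).PosSemidef) {T : ℝ} (hT : 1 ≤ T) (h1 : ∑ μ, (X μ).trace.re ≤ 1)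
    (h : ∑ μ, traceNorm (partialTranspose A (X μ)) + (1 - ∑ μ, (X μ).trace.re) ≤ T) :
    ∑ μ, (X μ).trace.re * negativity A (((X μ).trace.re : ℂ)⁻¹ • X μ) ≤ (T - 1) / 2 ∧
      ∑ μ, (X μ).trace.re * logNegativity A (((X μ).trace.re : ℂ)⁻¹ • X μ) ≤ Real.log T := by
  refine sum_negativity_le (fun μ => re_trace_nonneg_of_posSemidef (hX μ))
    (fun μ => traceNorm_normalized_pos A) h1 hT ?_
  simpa only [trace_mul_traceNorm_normalized A (hX _)] using h

/-- Partial transposition of a local measurement branch. -/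
theorem partialTranspose_sandwich {A : Finset (Fin N)} {Y Z X : Op N} (hY : Y ∈ evenSpan A)
    (hZ : Z ∈ evenSpan Aᶜ) (hX : X ∈ evenSpan Finset.univ) :
    partialTranspose A (Y * Z * X * (Y * Z)) =
      partialTranspose A Y * Z * partialTranspose A X * (partialTranspose A Y * Z) := by
  have hY' := evenSpan_mono (Finset.subset_univ _) hY
  have hZ' := evenSpan_mono (Finset.subset_univ _) hZ
  have hTY := partialTranspose_mem_evenSpan (A := A) hY
  rw [← Matrix.mul_assoc, partialTranspose_mul_right_compl hZ
      (mul_mem_evenSpan (mul_mem_evenSpan (mul_mem_evenSpan hY' hZ') hX) hY'),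
    partialTranspose_mul_right hY (mul_mem_evenSpan (mul_mem_evenSpan hY' hZ') hX),
    Matrix.mul_assoc Y, partialTranspose_mul_left hY (mul_mem_evenSpan hZ' hX),
    partialTranspose_mul_left_compl hZ hX]
  simp only [Matrix.mul_assoc]

theorem isStarProjection_mul {P Q : Op N} (hP : IsStarProjection P) (hQ : IsStarProjection Q)
    (h : P * Q = Q * P) : IsStarProjection (P * Q) := by
  constructor
  · change _ * _ = _
    rw [Matrix.mul_assoc, ← Matrix.mul_assoc Q, ← h, Matrix.mul_assoc, hQ.isIdempotentElem,
      ← Matrix.mul_assoc, hP.isIdempotentElem]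
  · change star _ = _
    rw [star_mul, hP.isSelfAdjoint, hQ.isSelfAdjoint, h]

theorem local_measurement_monotone {A : Finset (Fin N)} {ρ : Op N} (hρ : IsDensity ρ) {ι : Type*}
    [Fintype ι] {PA PB : ι → Op N}
    (hA : ∀ μ, IsLocalPhysical A (PA μ) ∧ IsStarProjection (PA μ))
    (hB : ∀ μ, IsLocalPhysical Aᶜ (PB μ) ∧ IsStarProjection (PB μ))
    (hAB : ∀ μ ν, μ ≠ ν → (PA μ * PB μ) * (PA ν * PB ν) = 0) :
    (∀ μ, 0 ≤ outcomeProb (PA μ * PB μ) ρ) ∧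
      (∑ μ, PA μ * PB μ = 1 → ∑ μ, outcomeProb (PA μ * PB μ) ρ = 1) ∧
      ∑ μ, outcomeProb (PA μ * PB μ) ρ * negativity A (outcomeState (PA μ * PB μ) ρ) ≤
        negativity A ρ ∧
      ∑ μ, outcomeProb (PA μ * PB μ) ρ * logNegativity A (outcomeState (PA μ * PB μ) ρ) ≤
        logNegativity A ρ := by
  have eA : ∀ μ, PA μ ∈ evenSpan A := fun μ => (hA μ).1.mem_evenSpan
  have eB : ∀ μ, PB μ ∈ evenSpan Aᶜ := fun μ => (hB μ).1.mem_evenSpan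
  have eρ := hρ.physical.mem_evenSpan
  have hP : ∀ μ, IsStarProjection (PA μ * PB μ) := fun μ =>
    isStarProjection_mul (hA μ).2 (hB μ).2 (commute_of_mem_evenSpan (eA μ) (eB μ))
  have hX : ∀ μ, (PA μ * PB μ * ρ * (PA μ * PB μ)).PosSemidef := by
    intro μ
    have h := hρ.posSemidef.mul_mul_conjTranspose_same (PA μ * PB μ)
    rwa [show (PA μ * PB μ)ᴴ = PA μ * PB μ from (hP μ).isSelfAdjoint] at h
  have htr : ∑ μ, outcomeProb (PA μ * PB μ) ρ = ((∑ μ, PA μ * PB μ) * ρ).trace.re := by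
    rw [Matrix.sum_mul, trace_sum, Complex.re_sum]
    refine Finset.sum_congr rfl fun μ _ => ?_
    rw [outcomeProb, trace_mul_comm, ← Matrix.mul_assoc, (hP μ).isIdempotentElem]
  have hS : IsStarProjection (∑ μ, PA μ * PB μ) := by
    classical
    constructor
    · change _ * _ = _
      rw [Finset.sum_mul]
      refine Finset.sum_congr rfl fun μ _ => ?_
      rw [Finset.mul_sum, Finset.sum_eq_single μ (fun ν _ h => hAB μ ν h.symm) (by simp),
        (hP μ).isIdempotentElem]
    · change star _ = _
      rw [star_sum]
      exact Finset.sum_congr rfl fun μ _ => (hP μ).isSelfAdjoint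
  -- The measurement may be incomplete: `∑ P^μ` is only a projection, so the total probability is at
  -- most `1`.
  have hsum : ∑ μ, outcomeProb (PA μ * PB μ) ρ ≤ 1 := by
    have h := (IsContraction.of_isStarProjection hS).re_trace_le hρ.posSemidef
    rwa [← htr, hρ.trace_eq_one, Complex.one_re] at h
  have eQ : ∀ μ, partialTranspose A (PA μ) ∈ evenSpan A := fun μ =>
    partialTranspose_mem_evenSpan (eA μ)
  have hQ : ∀ μ, IsStarProjection (partialTranspose A (PA μ) * PB μ) := fun μ =>
    isStarProjection_mul (isStarProjection_partialTranspose (eA μ) (hA μ).2) (hB μ).2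
      (commute_of_mem_evenSpan (eQ μ) (eB μ))
  have hQQ : ∀ μ ν, μ ≠ ν → (partialTranspose A (PA μ) * PB μ) *
      (partialTranspose A (PA ν) * PB ν) = 0 := by
    intro μ ν hμν
    have swap : ∀ {C D : Op N}, C ∈ evenSpan A → D ∈ evenSpan A →
        C * PB μ * (D * PB ν) = C * D * (PB μ * PB ν) := by
      intro C D _ hD
      rw [Matrix.mul_assoc, ← Matrix.mul_assoc (PB μ), ← commute_of_mem_evenSpan hD (eB μ)]
      simp only [Matrix.mul_assoc]
    have h := hAB μ ν hμν
    rw [swap (eA μ) (eA ν)] at h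
    rw [swap (eQ μ) (eQ ν)]
    -- Transposition reverses the `A`-factors, so the orthogonality needed is that of `PA ν * PA μ`,
    -- obtained by taking adjoints; the `B`-factors are untouched.
    rcases eq_zero_or_eq_zero_of_mul_eq_zero (mul_mem_evenSpan (eA μ) (eA ν))
      (mul_mem_evenSpan (eB μ) (eB ν)) h with h0 | h0
    · have h1 := congrArg star h0
      rw [star_mul, (hA μ).2.isSelfAdjoint, (hA ν).2.isSelfAdjoint, star_zero] at h1
      rw [← partialTranspose_mul_left (eA ν) (evenSpan_mono (Finset.subset_univ _) (eA μ)), h1,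
        partialTranspose_zero, Matrix.zero_mul]
    · rw [h0, Matrix.mul_zero]
  have hpinch := sum_traceNorm_pinching_le hQ hQQ (partialTranspose A ρ)
  simp only [← partialTranspose_sandwich (eA _) (eB _) eρ, trace_partialTranspose,
    hρ.trace_eq_one, Complex.one_re] at hpinch
  obtain ⟨h1, h2⟩ := sum_negativity_normalized_le hX (hρ.one_le_traceNorm A) hsum hpinch
  refine ⟨fun μ => re_trace_nonneg_of_posSemidef (hX μ), fun h => ?_, h1, h2⟩
  rw [htr, h, one_mul, hρ.trace_eq_one, Complex.one_re]

theorem ancilla_measurement_monotone {A : Finset (Fin N)} {ρ : Op N} (hρ : IsDensity ρ)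
    {ρR : Op M} (hρR : IsDensity ρR) {U : Op (M + N)}
    (hU : U ∈ Matrix.unitaryGroup (Occ (M + N)) ℂ) (hUA : IsLocalPhysical (withAncilla M A) U)
    {ι : Type*} [Fintype ι] (b : OrthonormalBasis ι ℂ (Fock M))
    (hb : ∀ μ, HasDefiniteParity (b μ)) :
    (∀ μ, 0 ≤ ancillaProb (b μ) (entangled U ρR ρ)) ∧
      ∑ μ, ancillaProb (b μ) (entangled U ρR ρ) = 1 ∧
      traceAncilla (entangled U ρR ρ) = ∑ μ, (ancillaProb (b μ) (entangled U ρR ρ) : ℂ) •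
        ancillaState (b μ) (entangled U ρR ρ) ∧
      ∑ μ, ancillaProb (b μ) (entangled U ρR ρ) *
        negativity A (ancillaState (b μ) (entangled U ρR ρ)) ≤ negativity A ρ ∧
      negativity A (∑ μ, (ancillaProb (b μ) (entangled U ρR ρ) : ℂ) •
        ancillaState (b μ) (entangled U ρR ρ)) ≤ negativity A ρ ∧
      ∑ μ, ancillaProb (b μ) (entangled U ρR ρ) *
        logNegativity A (ancillaState (b μ) (entangled U ρR ρ)) ≤ logNegativity A ρ := by
  classical
  have eU := hUA.mem_evenSpan
  have eU' := evenSpan_mono (Finset.subset_univ _) eU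
  have eUs := conjTranspose_mem_evenSpan eU
  have eρ := tensor_mem_evenSpan hρR.physical.mem_evenSpan hρ.physical.mem_evenSpan
  have hUU : Uᴴ * U = 1 := (Unitary.mem_iff.1 hU).1
  have hUU' : U * Uᴴ = 1 := (Unitary.mem_iff.1 hU).2
  set X := entangled U ρR ρ with hXdef
  have eX : X ∈ evenSpan Finset.univ := mul_mem_evenSpan (mul_mem_evenSpan eU' eρ)
    (conjTranspose_mem_evenSpan eU')
  have hXpos : X.PosSemidef :=
    (posSemidef_tensor hρR.posSemidef hρ.posSemidef).mul_mul_conjTranspose_same U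
  have hXtr : X.trace = 1 := by
    rw [hXdef, entangled, trace_mul_comm, ← Matrix.mul_assoc, hUU, one_mul, trace_tensor,
      hρR.trace_eq_one, hρ.trace_eq_one, one_mul]
  -- The transposed evolution is `(Uᵀ)ᴴ (ρ_R ⊗ ρ)ᵀ Uᵀ` with `Uᵀ` unitary, and the ancilla state is
  -- then stripped off.
  have hXT : traceNorm (partialTranspose (withAncilla M A) X) ≤
      traceNorm (partialTranspose A ρ) := by
    rw [← hρR.traceNorm_partialTranspose_tensor A hρ.physical.mem_evenSpan, hXdef, entangled,
      partialTranspose_mul_right eUs (mul_mem_evenSpan eU' eρ), partialTranspose_mul_left eU eρ,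
      ← Matrix.mul_assoc, partialTranspose_conjTranspose eU]
    refine traceNorm_mul_mul_le ?_ ?_ _
    · refine IsContraction.of_conjTranspose_mul_self_eq_one ?_
      rw [conjTranspose_conjTranspose, ← partialTranspose_conjTranspose eU,
        ← partialTranspose_mul_left eUs eU', hUU, partialTranspose_one]
    · refine IsContraction.of_conjTranspose_mul_self_eq_one ?_
      rw [← partialTranspose_conjTranspose eU,
        ← partialTranspose_mul_right eUs eU', hUU', partialTranspose_one]
  have hb1 : ∀ μ, ‖b μ‖ = 1 := b.orthonormal.1
  have hD := fun μ => isDensity_rankOne (hb1 μ) (hb μ)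
  have eR : ∀ μ, tensor (rankOne (b μ)) 1 ∈ evenSpan (withAncilla M A) := fun μ =>
    tensor_one_mem_evenSpan A (hD μ).physical.mem_evenSpan
  have hσ : ∀ μ, (ancillaSandwich (b μ) X).PosSemidef := fun μ =>
    posSemidef_ancillaSandwich (b μ) hXpos
  have eσ : ∀ μ, ancillaSandwich (b μ) X ∈ evenSpan Finset.univ := fun μ =>
    (isPhysical_ancillaSandwich (hb1 μ) (hb μ) eX).mem_evenSpan
  have hsum : ∑ μ, ancillaProb (b μ) X = 1 := by
    simp only [ancillaProb]
    rw [← Complex.re_sum, ← trace_sum, sum_ancillaSandwich, trace_traceAncilla, hXtr,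
      Complex.one_re]
  have hQ : ∀ μ, IsStarProjection
      (partialTranspose (withAncilla M A) (tensor (rankOne (b μ)) (1 : Op N))) := fun μ =>
    isStarProjection_partialTranspose (eR μ) (isStarProjection_rankOne_tensor (hb1 μ))
  have hQQ : ∀ μ ν, μ ≠ ν →
      partialTranspose (withAncilla M A) (tensor (rankOne (b μ)) (1 : Op N)) *
        partialTranspose (withAncilla M A) (tensor (rankOne (b ν)) (1 : Op N)) = 0 := by
    intro μ ν hμν
    rw [← partialTranspose_mul_left (eR ν) (evenSpan_mono (Finset.subset_univ _) (eR μ)),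
      tensor_mul_tensor, rankOne_mul_rankOne (b.orthonormal.2 hμν.symm), ← tensorLinear_apply,
      map_zero, LinearMap.zero_apply, partialTranspose_zero]
  have hT : ∀ μ, partialTranspose (withAncilla M A) (tensor (rankOne (b μ)) (1 : Op N)) *
      partialTranspose (withAncilla M A) X *
        partialTranspose (withAncilla M A) (tensor (rankOne (b μ)) (1 : Op N)) =
      partialTranspose (withAncilla M A) (tensor (rankOne (b μ)) (ancillaSandwich (b μ) X)) := by
    intro μ
    rw [← rankOne_tensor_mul_mul, partialTranspose_mul_right (eR μ)
      (mul_mem_evenSpan (evenSpan_mono (Finset.subset_univ _) (eR μ)) eX),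
      partialTranspose_mul_left (eR μ) eX, Matrix.mul_assoc]
  have hpinch := (sum_traceNorm_pinching_le hQ hQQ (partialTranspose (withAncilla M A) X)).trans hXT
  simp only [hT, (hD _).traceNorm_partialTranspose_tensor A (eσ _), trace_partialTranspose,
    trace_tensor, (hD _).trace_eq_one, one_mul, hXtr, Complex.one_re] at hpinch
  obtain ⟨h1, h2⟩ := sum_negativity_normalized_le hσ (hρ.one_le_traceNorm A) hsum.le hpinch
  have hst : ∑ μ, (ancillaProb (b μ) X : ℂ) • ancillaState (b μ) X =
      ∑ μ, ancillaSandwich (b μ) X :=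
    Finset.sum_congr rfl fun μ _ => smul_smul_inv_eq (hσ μ)
  refine ⟨fun μ => re_trace_nonneg_of_posSemidef (hσ μ), hsum, ?_, h1, ?_, h2⟩
  · rw [hst, sum_ancillaSandwich]
  · rw [hst, negativity, negativity, partialTranspose_sum]
    have h3 := traceNorm_sum_le Finset.univ fun μ => partialTranspose A (ancillaSandwich (b μ) X)
    have h4 : ∑ μ, (ancillaSandwich (b μ) X).trace.re = 1 := hsum
    linarith

end Measurements

end Fermion

end

theorem mainTheorem6 {N : ℕ} (A : Finset (Fin N)) (ρ : Fermion.Op N) (hρ : Fermion.IsDensity ρ) :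
    -- appending an unentangled local ancilla
    (∀ (M : ℕ) (ρR : Fermion.Op M), Fermion.IsDensity ρR →
      Fermion.negativity (Fermion.withAncilla M A) (Fermion.tensor ρR ρ) =
          Fermion.negativity A ρ ∧
        Fermion.logNegativity (Fermion.withAncilla M A) (Fermion.tensor ρR ρ) =
          Fermion.logNegativity A ρ) ∧
    -- local orthogonal projective measurements
    (∀ (ι : Type) [Fintype ι] (PA PB : ι → Fermion.Op N),
      (∀ μ, Fermion.IsLocalPhysical A (PA μ) ∧ IsStarProjection (PA μ)) →
      (∀ μ, Fermion.IsLocalPhysical Aᶜ (PB μ) ∧ IsStarProjection (PB μ)) →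
      (∀ μ ν, μ ≠ ν → (PA μ * PB μ) * (PA ν * PB ν) = 0) →
      (∀ μ, 0 ≤ Fermion.outcomeProb (PA μ * PB μ) ρ) ∧
      (∑ μ, PA μ * PB μ = 1 → ∑ μ, Fermion.outcomeProb (PA μ * PB μ) ρ = 1) ∧
      ∑ μ, Fermion.outcomeProb (PA μ * PB μ) ρ *
          Fermion.negativity A (Fermion.outcomeState (PA μ * PB μ) ρ) ≤
        Fermion.negativity A ρ ∧
      ∑ μ, Fermion.outcomeProb (PA μ * PB μ) ρ *
          Fermion.logNegativity A (Fermion.outcomeState (PA μ * PB μ) ρ) ≤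
        Fermion.logNegativity A ρ) ∧
    -- entangling with a local ancilla, then measuring the ancilla or tracing it out
    (∀ (M : ℕ) (ρR : Fermion.Op M), Fermion.IsDensity ρR →
      ∀ U : Fermion.Op (M + N), U ∈ Matrix.unitaryGroup (Fermion.Occ (M + N)) ℂ →
      Fermion.IsLocalPhysical (Fermion.withAncilla M A) U →
      ∀ (ι : Type) [Fintype ι] (b : OrthonormalBasis ι ℂ (Fermion.Fock M)),
      (∀ μ, Fermion.HasDefiniteParity (b μ)) →
      (∀ μ, 0 ≤ Fermion.ancillaProb (b μ) (Fermion.entangled U ρR ρ)) ∧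
      ∑ μ, Fermion.ancillaProb (b μ) (Fermion.entangled U ρR ρ) = 1 ∧
      Fermion.traceAncilla (Fermion.entangled U ρR ρ) =
        ∑ μ, (Fermion.ancillaProb (b μ) (Fermion.entangled U ρR ρ) : ℂ) •
          Fermion.ancillaState (b μ) (Fermion.entangled U ρR ρ) ∧
      ∑ μ, Fermion.ancillaProb (b μ) (Fermion.entangled U ρR ρ) *
          Fermion.negativity A (Fermion.ancillaState (b μ) (Fermion.entangled U ρR ρ)) ≤
        Fermion.negativity A ρ ∧
      Fermion.negativity A
          (∑ μ, (Fermion.ancillaProb (b μ) (Fermion.entangled U ρR ρ) : ℂ) •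
            Fermion.ancillaState (b μ) (Fermion.entangled U ρR ρ)) ≤
        Fermion.negativity A ρ ∧
      ∑ μ, Fermion.ancillaProb (b μ) (Fermion.entangled U ρR ρ) *
          Fermion.logNegativity A (Fermion.ancillaState (b μ) (Fermion.entangled U ρR ρ)) ≤
        Fermion.logNegativity A ρ) := by
  refine ⟨fun M ρR hρR => ?_, fun ι _ PA PB hA hB hAB => ?_, fun M ρR hρR U hU hUA ι _ b hb => ?_⟩
  · have h := hρR.traceNorm_partialTranspose_tensor A hρ.physical.mem_evenSpan
    exact ⟨by rw [Fermion.negativity, Fermion.negativity, h],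
      by rw [Fermion.logNegativity, Fermion.logNegativity, h]⟩
  · exact Fermion.local_measurement_monotone hρ hA hB hAB
  · exact Fermion.ancilla_measurement_monotone hρ hρR hU hUA b hb
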